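/- \textbf{Theorem 1 (Closed-loop Stability and Robustness).} Let $\mathbb G^3$ be the geometric (Clifford) algebra of Euclidean space $\mathbb R^3$ with orthonormal basis $\mathbf e_1,\mathbf e_2,\mathbf e_3$, let $M\mapsto M^\dagger$ be reversion, and for $a=[a_{12},a_{23},a_{31}]^\top\in\mathbb R^3$ put $R(a)=\exp\!\big(-\tfrac12(a_{12}\mathbf e_1\mathbf e_2+a_{23}\mathbf e_2\mathbf e_3+a_{31}\mathbf e_3\mathbf e_1)\big)$. Let $m>0$ and $g_0\in\mathbb R$ (mass and gravity coefficient), let $\tau:[0,\infty)\to\mathbb R^3$ be continuous with $\|\tau(t)\|=1$ (thrust direction relative to the reference copy of the body; a constant $\tau$ is allowed), let $\xi_{\mathrm d}:[0,\infty)\to\mathbb R^3$ be a $C^2$ desired position with $\sup_{t\ge0}\|\ddot\xi_{\mathrm d}(t)\|<\infty$, and let $\dot\Omega_{\mathrm d}$ be any $\mathbb R^3$-valued function of time, state and perturbation (desired angular acceleration). With $$A_1=A_2=\begin{bmatrix}0&I\\0&0\end{bmatrix}\in\mathbb R^{6\times6},\qquad B_1=B_2=\begin{bmatrix}0\\I\end{bmatrix}\in\mathbb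 R^{6\times3},$$ consider the tracking-error dynamics with state $x=(x_1,x_2)\in\mathbb R^6\times\mathbb R^6$, perturbation $w(t)\in\mathbb R^3$ and inputs $u_1,u_2\in\mathbb R^3$, $$\dot x_1=A_1x_1+B_1\big(u_1-\ddot\xi_{\mathrm d}(t)\big)+g(t,x_1,x_2)+\begin{bmatrix}0\\w(t)\end{bmatrix},\qquad \dot x_2=A_2x_2+B_2\big(u_2-\dot\Omega_{\mathrm d}\big),$$ $$g(t,x_1,x_2)=\begin{bmatrix}0\\ \tfrac fm\,t_{\mathrm e}\end{bmatrix},\qquad f=m\,\|u_1-g_0\mathbf e_3\|,\qquad t_{\mathrm e}=R(\theta)\,\tau(t)\,R(\theta)^\dagger-\tau(t),$$ where $\theta\in\mathbb R^3$ (the angular error) is the upper half of $x_2$. Let $u_1=-K_1x_1+\ddot\xi_{\mathrm d}(t)$ and $u_2=-K_2x_2+\dot\Omega_{\mathrm d}$, where $K_1,K_2\in\mathbb R^{3\times6}$ are such that $A_1-B_1K_1$ and $A_2-B_2K_2$ are Hurwitz. Then, for every measurable, locally essentially bounded $w:[0,\infty)\to\mathbb R^3$, every $t_0\ge0$ and every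 initial state at $t_0$, the closed loop has a (Carath\'eodory) solution on $[t_0,\infty)$, and the closed loop is Strongly iISS with respect to $w$, that is: \begin{itemize} \item (ISS with respect to small inputs) there are $R>0$, $\beta\in\mathcal{KL}$, $\mu\in\mathcal K_\infty$ such that for all $t\ge t_0\ge0$, all such $w$ with $\|w(s)\|<R$ for $s\in[t_0,t]$, and all solutions $x$ on $[t_0,t]$, $\|x(t)\|\le\beta(\|x(t_0)\|,t-t_0)+\mu\big(\sup_{t_0\le s\le t}\|w(s)\|\big)$; and \item (iISS) there are $\beta\in\mathcal{KL}$, $\mu_1,\mu_2\in\mathcal K_\infty$ such that for all $t\ge t_0\ge0$, all such $w$ and all solutions $x$ on $[t_0,t]$, $\|x(t)\|\le\beta(\|x(t_0)\|,t-t_0)+\mu_1\big(\int_{t_0}^t\mu_2(\|w(s)\|)\,ds\big)$. \end{itemize} In particular the closed loop is 0-UGAS: there is $\beta\in\mathcal{KL}$ such that for all $t\ge t_0\ge0$ every solution on $[t_0,t]$ with $w\equiv0$ satisfies $\|x(t)\|\le\beta(\|x(t_0)\|,t-t_0)$. Here $\alpha:[0,\infty)\to[0,\infty)$ is of class $\mathcal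 K$ if it is continuous, strictly increasing and $\alpha(0)=0$, and of class $\mathcal K_\infty$ if moreover it is unbounded; $\beta$ is of class $\mathcal{KL}$ if $\beta(\cdot,s)\in\mathcal K$ for every $s\ge0$ and, for every $r\ge0$, $\beta(r,\cdot)$ is nonincreasing with $\beta(r,s)\to0$ as $s\to\infty$. -/

import Mathlib

open MeasureTheory Set Filter Topology

noncomputable section

namespace GATracking

/-! ### Comparison functions and stability notions for time-varying systems with inputs -/

/-- Class `𝒦`, for functions on `[0, ∞)` (values at negative arguments are irrelevant). -/
def IsClassK (α : ℝ → ℝ) : Prop :=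
  ContinuousOn α (Ici 0) ∧ StrictMonoOn α (Ici 0) ∧ α 0 = 0

/-- Class `𝒦_∞`: class `𝒦` and unbounded. -/
def IsClassKInfty (α : ℝ → ℝ) : Prop :=
  IsClassK α ∧ ∀ M : ℝ, ∃ r : ℝ, 0 ≤ r ∧ M < α r

/-- Class `𝒦ℒ`. -/
def IsClassKL (β : ℝ → ℝ → ℝ) : Prop :=
  (∀ s : ℝ, 0 ≤ s → IsClassK (fun r => β r s)) ∧
  (∀ r : ℝ, 0 ≤ r → AntitoneOn (β r) (Ici 0) ∧ Tendsto (β r) atTop (𝓝 0))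

section Systems

variable {n k : Type*} [Fintype n] [Fintype k]

/-- Admissible inputs: (Lebesgue) measurable and locally essentially bounded on `[0, ∞)`. -/
def IsInput (w : ℝ → EuclideanSpace ℝ k) : Prop :=
  AEStronglyMeasurable w (volume.restrict (Ici (0 : ℝ))) ∧
  ∀ T : ℝ, ∃ C : ℝ, ∀ᵐ s ∂(volume.restrict (Icc (0 : ℝ) T)), ‖w s‖ ≤ C

/-- `x` is a (Carathéodory) solution of `ẋ = F(t, x, w)` on `[t₀, t₁]`: along `x` the right-hand
side is integrable, and `x` satisfies the integral equation on `[t₀, t₁]`. Equivalently, `x` is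
absolutely continuous on `[t₀, t₁]` and `ẋ(t) = F(t, x(t), w(t))` for almost every `t`. -/
def IsSolutionOn (F : ℝ → EuclideanSpace ℝ n → EuclideanSpace ℝ k → EuclideanSpace ℝ n)
    (w : ℝ → EuclideanSpace ℝ k) (x : ℝ → EuclideanSpace ℝ n) (t₀ t₁ : ℝ) : Prop :=
  IntervalIntegrable (fun s => F s (x s) (w s)) volume t₀ t₁ ∧
  ∀ t ∈ Icc t₀ t₁, x t = x t₀ + ∫ s in t₀..t, F s (x s) (w s)

/-- From every initial time and state, and for every input, there is a solution on `[t₀, ∞)`. -/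
def ForwardComplete
    (F : ℝ → EuclideanSpace ℝ n → EuclideanSpace ℝ k → EuclideanSpace ℝ n) : Prop :=
  ∀ w : ℝ → EuclideanSpace ℝ k, IsInput w → ∀ t₀ : ℝ, 0 ≤ t₀ → ∀ x₀ : EuclideanSpace ℝ n,
    ∃ x : ℝ → EuclideanSpace ℝ n, x t₀ = x₀ ∧ ∀ t : ℝ, t₀ ≤ t → IsSolutionOn F w x t₀ t

/-- Uniform global asymptotic stability under zero input (0-UGAS). -/
def IsZeroUGAS
    (F : ℝ → EuclideanSpace ℝ n → EuclideanSpace ℝ k → EuclideanSpace ℝ n) : Prop :=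
  ∃ β : ℝ → ℝ → ℝ, IsClassKL β ∧
    ∀ (x : ℝ → EuclideanSpace ℝ n) (t₀ t : ℝ), 0 ≤ t₀ → t₀ ≤ t →
      IsSolutionOn F (fun _ => 0) x t₀ t →
      ‖x t‖ ≤ β ‖x t₀‖ (t - t₀)

/-- Input-to-state stability with respect to small inputs. -/
def IsISSSmallInputs
    (F : ℝ → EuclideanSpace ℝ n → EuclideanSpace ℝ k → EuclideanSpace ℝ n) : Prop :=
  ∃ (R : ℝ) (β : ℝ → ℝ → ℝ) (μ : ℝ → ℝ), 0 < R ∧ IsClassKL β ∧ IsClassKInfty μ ∧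
    ∀ (w : ℝ → EuclideanSpace ℝ k) (x : ℝ → EuclideanSpace ℝ n) (t₀ t : ℝ),
      IsInput w → 0 ≤ t₀ → t₀ ≤ t → IsSolutionOn F w x t₀ t →
      (∀ s ∈ Icc t₀ t, ‖w s‖ < R) →
      ‖x t‖ ≤ β ‖x t₀‖ (t - t₀) + μ (sSup ((fun s => ‖w s‖) '' Icc t₀ t))

/-- Integral input-to-state stability (iISS). -/
def IsIISS
    (F : ℝ → EuclideanSpace ℝ n → EuclideanSpace ℝ k → EuclideanSpace ℝ n) : Prop :=
  ∃ (β : ℝ → ℝ → ℝ) (μ₁ μ₂ : ℝ → ℝ), IsClassKL β ∧ IsClassKInfty μ₁ ∧ IsClassKInfty μ₂ ∧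
    ∀ (w : ℝ → EuclideanSpace ℝ k) (x : ℝ → EuclideanSpace ℝ n) (t₀ t : ℝ),
      IsInput w → 0 ≤ t₀ → t₀ ≤ t → IsSolutionOn F w x t₀ t →
      ‖x t‖ ≤ β ‖x t₀‖ (t - t₀) + μ₁ (∫ s in t₀..t, μ₂ ‖w s‖)

/-- Strong iISS: ISS with respect to small inputs, and iISS. -/
def IsStronglyIISS
    (F : ℝ → EuclideanSpace ℝ n → EuclideanSpace ℝ k → EuclideanSpace ℝ n) : Prop :=
  IsISSSmallInputs F ∧ IsIISS F

end Systems

/-! ### The geometric algebra of Euclidean 3-space -/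

/-- Column matrices with three real entries, with the Euclidean norm. -/
abbrev E3 : Type := EuclideanSpace ℝ (Fin 3)

/-- The quadratic form `v ↦ v · v` on Euclidean 3-space. -/
def dotForm : QuadraticForm ℝ E3 := LinearMap.BilinMap.toQuadraticMap (innerₗ E3)

/-- The geometric algebra `𝔾³`: multivectors over Euclidean 3-space. -/
abbrev GA3 : Type := CliffordAlgebra dotForm

/-- The canonical topology of the finite-dimensional real vector space `𝔾³`. -/
instance : TopologicalSpace GA3 := moduleTopology ℝ GA3

/-- The vector of Euclidean 3-space with the given coordinates, as a multivector. -/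
def vec (v : E3) : GA3 := CliffordAlgebra.ι dotForm v

/-- The basis vectors `e₁, e₂, e₃` (indexed from `0`). -/
def basisVec (i : Fin 3) : E3 := EuclideanSpace.single i 1

/-- The bivector `a₁₂ e₁e₂ + a₂₃ e₂e₃ + a₃₁ e₃e₁` represented by `[a₁₂, a₂₃, a₃₁]ᵀ`. -/
def bivec (a : E3) : GA3 :=
  a 0 • (vec (basisVec 0) * vec (basisVec 1)) +
  a 1 • (vec (basisVec 1) * vec (basisVec 2)) +
  a 2 • (vec (basisVec 2) * vec (basisVec 0))

/-- The exponential of a multivector, by its power series. -/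
def gaExp (M : GA3) : GA3 := ∑' j : ℕ, ((j.factorial : ℝ)⁻¹) • M ^ j

/-- The rotor `exp(-B/2)` of the bivector angle `B` represented by `a`. -/
def rotor (a : E3) : GA3 := gaExp (-((1 / 2 : ℝ) • bivec a))

/-- The vector (grade one) part of a multivector, as a column matrix. -/
def vectorPart : GA3 →ₗ[ℝ] E3 :=
  ExteriorAlgebra.ιInv ∘ₗ (CliffordAlgebra.equivExterior dotForm).toLinearMap

/-- The rotation `R v R†` of the vector `v` by the bivector angle represented by `a`. -/
def rotate (a v : E3) : E3 :=
  vectorPart (rotor a * vec v * CliffordAlgebra.reverse (rotor a))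

/-! ### The tracking-error dynamics -/

/-- Column matrices with six real entries, in two blocks of three. -/
abbrev E6 : Type := EuclideanSpace ℝ (Fin 3 ⊕ Fin 3)

/-- The stacked column `[u; v]`. -/
def stack (u v : E3) : E6 := WithLp.toLp 2 (Sum.elim u v)

/-- The upper block of a column with six entries. -/
def upper (x : E6) : E3 := WithLp.toLp 2 (fun i => x (Sum.inl i))

/-- The full state `(x₁, x₂)`, with `x₁ = [ξₑ; dξₑ]` and `x₂ = [jₑθₑ; Ωₑ]`. -/
abbrev State : Type := EuclideanSpace ℝ ((Fin 3 ⊕ Fin 3) ⊕ (Fin 3 ⊕ Fin 3))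

/-- The full state with components `x₁` and `x₂`. -/
def mkState (x₁ x₂ : E6) : State := WithLp.toLp 2 (Sum.elim x₁ x₂)

/-- The translational state `x₁`. -/
def fstState (x : State) : E6 := WithLp.toLp 2 (fun i => x (Sum.inl i))

/-- The rotational state `x₂`. -/
def sndState (x : State) : E6 := WithLp.toLp 2 (fun i => x (Sum.inr i))

/-- The product of a real matrix and a column. -/
def mulCol {p q : Type} [Fintype q] (M : Matrix p q ℝ) (x : EuclideanSpace ℝ q) :
    EuclideanSpace ℝ p :=
  WithLp.toLp 2 (M.mulVec x)

/-- The double-integrator matrix `A₁ = A₂ = [0 I; 0 0]`. -/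
def matA : Matrix (Fin 3 ⊕ Fin 3) (Fin 3 ⊕ Fin 3) ℝ := Matrix.fromBlocks 0 1 0 0

/-- The input matrix `B₁ = B₂ = [0; I]`. -/
def matB : Matrix (Fin 3 ⊕ Fin 3) (Fin 3) ℝ := Matrix.fromRows 0 1

/-- A real square matrix is Hurwitz: all its complex eigenvalues have negative real part. -/
def IsHurwitz {p : Type} [Fintype p] [DecidableEq p] (M : Matrix p p ℝ) : Prop :=
  ∀ z ∈ spectrum ℂ (M.map (algebraMap ℝ ℂ)), z.re < 0

/-- The coefficient of thrust `f = m ‖u₁ - g e₃‖` that realizes the virtual input `u₁`. -/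
def thrust (m grav : ℝ) (u₁ : E3) : ℝ := m * ‖u₁ - grav • basisVec 2‖

/-- The thrust-direction error `tₑ = Rₑ τ Rₑ† - τ` with `Rₑ = exp(-jₑθₑ/2)`, where `a` represents
the angular error `jₑθₑ` and `τ` is the thrust direction relative to the reference copy of the
body. -/
def thrustError (a τ : E3) : E3 := rotate a τ - τ

/-- The interconnection term `g = [0; (f/m) tₑ]`. -/
def interconnection (m grav : ℝ) (τ u₁ : E3) (x₂ : E6) : E6 :=
  stack 0 ((thrust m grav u₁ / m) • thrustError (upper x₂) τ)

/-- Right-hand side of the tracking-error dynamics with inputs `u₁`, `u₂`, perturbation `w`, desired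
acceleration `acc` and desired angular acceleration `angAcc`:
`ẋ₁ = A₁ x₁ + B₁ (u₁ - acc) + g + [0; w]`, `ẋ₂ = A₂ x₂ + B₂ (u₂ - angAcc)`. -/
def trackingField (m grav : ℝ) (τ acc angAcc : E3) (x : State) (u₁ u₂ w : E3) : State :=
  mkState
    (mulCol matA (fstState x) + mulCol matB (u₁ - acc)
      + interconnection m grav τ u₁ (sndState x) + stack 0 w)
    (mulCol matA (sndState x) + mulCol matB (u₂ - angAcc))

/-- The desired acceleration: second time derivative of the desired position, on `[0, ∞)`. -/
def desiredAcc (ξd : ℝ → E3) (t : ℝ) : E3 := iteratedDerivWithin 2 ξd (Ici 0) t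

/-- The closed loop `ẋ = F(t, x, w)` of the tracking-error dynamics under
`u₁ = -K₁ x₁ + acc` and `u₂ = -K₂ x₂ + angAcc`. -/
def closedLoop (m grav : ℝ) (τ ξd : ℝ → E3) (angAcc : ℝ → State → E3 → E3)
    (K₁ K₂ : Matrix (Fin 3) (Fin 3 ⊕ Fin 3) ℝ) (t : ℝ) (x : State) (w : E3) : State :=
  trackingField m grav (τ t) (desiredAcc ξd t) (angAcc t x w) x
    (-mulCol K₁ (fstState x) + desiredAcc ξd t)
    (-mulCol K₂ (sndState x) + angAcc t x w) w

end GATracking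

end

noncomputable section

namespace GATracking

/-! ### Rotors -/

/-! After cancellation of the feedforward terms the closed loop is a cascade. The angular part is
the autonomous linear system `ẋ₂ = (A - B K₂) x₂`, which decays exponentially. The translational
part is `ẋ₁ = (A - B K₁) x₁ + coupling + [0; w]`. The thrust magnitude grows at most affinely in
`x₁`, because the desired acceleration is bounded, and the thrust-direction error is at most linear
in the angle. Hence the coupling is bounded by `C ‖x₂‖ (1 + ‖x₁‖)`: it may be large, but its gain
decays exponentially along every solution, so its total effect on `x₁` is finite.

Three ingredients make this quantitative. `exists_norm_thrustError_le` uses that the square of a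
bivector is a scalar, so that rotors have a closed form. `IsHurwitz.exists_norm_exp_le` obtains
exponential decay from the spectrum. `eq_exp_add_integral` is variation of constants for merely
integrable forcing. Combined with `cascade_gronwall` they give `exists_closedLoop_estimate`: if the
exponentially filtered input is bounded by `M`, then `‖x‖ ≤ β + M + M²/2`, the square coming from
Young's inequality applied to a product of initial state and input. Bounding the filter by the
integral of `‖w‖` gives iISS, and bounding it by the supremum gives ISS.

Existence follows the same cascade: `x₂` is explicit and bounded, after which the field for `x₁` is
globally Lipschitz and a weighted Picard iteration converges. -/

instance : IsModuleTopology ℝ GA3 := ⟨rfl⟩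

instance : ContinuousAdd GA3 := IsModuleTopology.toContinuousAdd ℝ GA3

/-- Limits must be unique for the rotor series to be identified by its sum. Linear functionals
separate points and are continuous for the module topology. -/
instance : T2Space GA3 := by
  refine ⟨fun x y hxy => ?_⟩
  have h : ∃ f : Module.Dual ℝ GA3, f (x - y) ≠ 0 := by
    by_contra! h
    exact hxy (sub_eq_zero.1 ((Module.forall_dual_apply_eq_zero_iff ℝ (x - y)).1 h))
  obtain ⟨f, hf⟩ := h
  refine separated_by_continuous (IsModuleTopology.continuous_of_linearMap f) fun h => hf ?_
  rw [map_sub, h, sub_self]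

lemma vec_mul_self (v : E3) : vec v * vec v = (‖v‖ ^ 2) • (1 : GA3) := by
  rw [vec, CliffordAlgebra.ι_sq_scalar, Algebra.algebraMap_eq_smul_one]
  congr 1
  simp [dotForm]

lemma vec_basis_mul_self (i : Fin 3) : vec (basisVec i) * vec (basisVec i) = 1 := by
  simp [vec_mul_self, basisVec]

lemma vec_basis_anticomm {i j : Fin 3} (h : i ≠ j) :
    vec (basisVec j) * vec (basisVec i) = -(vec (basisVec i) * vec (basisVec j)) := by
  have := CliffordAlgebra.ι_mul_ι_add_swap (Q := dotForm) (basisVec j) (basisVec i)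
  have hp : QuadraticMap.polar dotForm (basisVec j) (basisVec i) = 0 := by
    simp [QuadraticMap.polar, dotForm, basisVec, inner_add_right,
      EuclideanSpace.inner_single_left, h, h.symm]
  rw [hp, map_zero] at this
  exact eq_neg_of_add_eq_zero_left this

/-- The cross terms cancel because distinct basis bivectors of 3-space anticommute. A scalar square
is what reduces the exponential to cosine and sine. -/
lemma bivec_mul_self (a : E3) : bivec a * bivec a = -((‖a‖ ^ 2) • (1 : GA3)) := by
  have hx := vec_basis_mul_self 0
  have hy := vec_basis_mul_self 1
  have hz := vec_basis_mul_self 2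
  have hxy := vec_basis_anticomm (i := 0) (j := 1) (by decide)
  have hxz := vec_basis_anticomm (i := 0) (j := 2) (by decide)
  have hyz := vec_basis_anticomm (i := 1) (j := 2) (by decide)
  have hn : ‖a‖ ^ 2 = a 0 ^ 2 + a 1 ^ 2 + a 2 ^ 2 := by
    simp [EuclideanSpace.norm_sq_eq, Fin.sum_univ_three]
  rw [hn]
  unfold bivec
  generalize vec (basisVec 0) = x at *
  generalize vec (basisVec 1) = y at *
  generalize vec (basisVec 2) = z at *
  -- The primed rules perform the same reordering inside right-associated words, so that every word
  -- reaches the order `x, y, z` without repetitions.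
  have hx' : ∀ w, x * (x * w) = w := fun w => by rw [← mul_assoc, hx, one_mul]
  have hy' : ∀ w, y * (y * w) = w := fun w => by rw [← mul_assoc, hy, one_mul]
  have hxy' : ∀ w, y * (x * w) = -(x * (y * w)) := fun w => by
    rw [← mul_assoc, hxy, neg_mul, mul_assoc]
  have hxz' : ∀ w, z * (x * w) = -(x * (z * w)) := fun w => by
    rw [← mul_assoc, hxz, neg_mul, mul_assoc]
  have hyz' : ∀ w, z * (y * w) = -(y * (z * w)) := fun w => by
    rw [← mul_assoc, hyz, neg_mul, mul_assoc]
  simp only [mul_add, add_mul, smul_mul_assoc, mul_smul_comm, mul_assoc, hx, hy, hz, hxy, hxz, hyz,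
    hx', hy', hxy', hxz', hyz', mul_neg, neg_mul, neg_neg, mul_one, smul_neg]
  module

lemma hasSum_sinc (q : ℝ) :
    HasSum (fun k : ℕ => (-1) ^ k * q ^ (2 * k) / ((2 * k + 1).factorial : ℝ)) (Real.sinc q) := by
  rcases eq_or_ne q 0 with rfl | hq
  · rw [Real.sinc_zero]
    have h := hasSum_single (f := fun k : ℕ =>
      (-1) ^ k * (0 : ℝ) ^ (2 * k) / ((2 * k + 1).factorial : ℝ)) 0 fun k hk => by simp [hk]
    simpa using h
  · rw [Real.sinc_of_ne_zero hq]
    convert! (Real.hasSum_sin q).div_const q using 1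
    ext k
    rw [pow_succ]
    field_simp

/-- Even powers of `M` are scalars and odd powers are multiples of `M`, so the series splits into
those of `cos` and `sinc`. Using `sinc` avoids dividing by `q = 0`. -/
lemma hasSum_exp_of_mul_self {M : GA3} {q : ℝ} (hM : M * M = -((q ^ 2) • (1 : GA3))) :
    HasSum (fun j : ℕ => ((j.factorial : ℝ)⁻¹) • M ^ j)
      (Real.cos q • (1 : GA3) + Real.sinc q • M) := by
  have hM2 : ∀ k : ℕ, M ^ (2 * k) = ((-1) ^ k * q ^ (2 * k) : ℝ) • (1 : GA3) := by
    intro k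
    rw [pow_mul, pow_two, hM, ← neg_smul, smul_pow, one_pow, neg_pow, ← pow_mul]
  refine HasSum.even_add_odd ?_ ?_
  · convert! (Real.hasSum_cos q).smul_const (1 : GA3) using 2 with k
    rw [hM2, smul_smul]
    congr 1
    ring
  · convert! (hasSum_sinc q).smul_const M using 2 with k
    rw [pow_succ, hM2, smul_mul_assoc, one_mul, smul_smul]
    congr 1
    ring

lemma rotor_eq (a : E3) :
    rotor a = Real.cos (‖a‖ / 2) • (1 : GA3) - (Real.sinc (‖a‖ / 2) / 2) • bivec a := by
  have hM : (-((1 / 2 : ℝ) • bivec a)) * (-((1 / 2 : ℝ) • bivec a)) =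
      -(((‖a‖ / 2) ^ 2) • (1 : GA3)) := by
    rw [neg_mul_neg, smul_mul_smul_comm, bivec_mul_self]
    module
  rw [rotor, gaExp, (hasSum_exp_of_mul_self hM).tsum_eq]
  module

lemma vectorPart_vec (v : E3) : vectorPart (vec v) = v := by
  simp only [vectorPart, vec, LinearMap.comp_apply, LinearEquiv.coe_coe,
    CliffordAlgebra.equivExterior, CliffordAlgebra.changeFormEquiv_apply,
    CliffordAlgebra.changeForm_ι]
  exact ExteriorAlgebra.ι_leftInverse v

/-- The even multivector with scalar part `p.1` and bivector part `-p.2 / 2`. -/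
def evenPart : ℝ × E3 →ₗ[ℝ] GA3 where
  toFun p := p.1 • (1 : GA3) - (1 / 2 : ℝ) • bivec p.2
  map_add' p q := by
    simp only [bivec, Prod.fst_add, Prod.snd_add, PiLp.add_apply]
    module
  map_smul' c p := by
    simp only [bivec, Prod.smul_fst, Prod.smul_snd, PiLp.smul_apply, smul_eq_mul, RingHom.id_apply]
    module

set_option maxSynthPendingDepth 3 in
/-- The bilinear map `(X, Y) ↦ (v ↦ ⟨X v Y†⟩₁)` on even multivectors. -/
def sandwichₗ : ℝ × E3 →ₗ[ℝ] ℝ × E3 →ₗ[ℝ] E3 →L[ℝ] E3 :=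
  LinearMap.mk₂ ℝ (fun p q => LinearMap.toContinuousLinearMap
      (vectorPart ∘ₗ LinearMap.mulLeft ℝ (evenPart p) ∘ₗ
        LinearMap.mulRight ℝ (CliffordAlgebra.reverse (evenPart q)) ∘ₗ CliffordAlgebra.ι dotForm))
    (fun p p' q => by ext1 v; simp [add_mul])
    (fun c p q => by ext1 v; simp)
    (fun p q q' => by ext1 v; simp [mul_add])
    (fun c p q => by ext1 v; simp)

set_option maxSynthPendingDepth 3 in
/-- `sandwichₗ` as a continuous bilinear map. -/
def sandwich : ℝ × E3 →L[ℝ] ℝ × E3 →L[ℝ] E3 →L[ℝ] E3 :=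
  LinearMap.toContinuousLinearMap
    ((LinearMap.toContinuousLinearMap (𝕜 := ℝ) (E := ℝ × E3) (F' := E3 →L[ℝ] E3)).toLinearMap ∘ₗ
      sandwichₗ)

lemma sandwich_apply (p q : ℝ × E3) (v : E3) :
    sandwich p q v =
      vectorPart (evenPart p * vec v * CliffordAlgebra.reverse (evenPart q)) := by
  rw [mul_assoc]
  rfl

/-- The parameters of the rotor of `a` as an even multivector. -/
def rotorParam (a : E3) : ℝ × E3 := (Real.cos (‖a‖ / 2), Real.sinc (‖a‖ / 2) • a)

lemma evenPart_rotorParam (a : E3) : evenPart (rotorParam a) = rotor a := by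
  rw [rotor_eq]
  simp only [evenPart, rotorParam, bivec, LinearMap.coe_mk, AddHom.coe_mk, PiLp.smul_apply,
    smul_eq_mul]
  module

lemma rotate_eq (a v : E3) : rotate a v = sandwich (rotorParam a) (rotorParam a) v := by
  rw [sandwich_apply, evenPart_rotorParam, rotate]

lemma sandwich_one_one (v : E3) : sandwich (1, 0) (1, 0) v = v := by
  have h : evenPart (1, 0) = 1 := by simp [evenPart, bivec]
  rw [sandwich_apply, h, CliffordAlgebra.reverse.map_one, one_mul, mul_one, vectorPart_vec]

lemma continuous_rotorParam : Continuous rotorParam := by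
  have := Real.continuous_sinc
  unfold rotorParam
  fun_prop

lemma norm_sinc_smul (a : E3) : ‖Real.sinc (‖a‖ / 2) • a‖ = 2 * |Real.sin (‖a‖ / 2)| := by
  rcases eq_or_ne a 0 with rfl | ha
  · simp
  · have hn : ‖a‖ ≠ 0 := norm_ne_zero_iff.2 ha
    rw [Real.sinc_of_ne_zero (by positivity), norm_smul, Real.norm_eq_abs, abs_div,
      abs_of_nonneg (by positivity : 0 ≤ ‖a‖ / 2)]
    field_simp

lemma norm_rotorParam_le (a : E3) : ‖rotorParam a‖ ≤ 2 := by
  refine max_le ?_ ?_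
  · exact (Real.abs_cos_le_one _).trans (by norm_num)
  · rw [rotorParam, norm_sinc_smul]
    linarith [Real.abs_sin_le_one (‖a‖ / 2)]

/-- The half-angle identity `cos x - 1 = -2 sin² (x / 2)` and `|sin x| ≤ |x|` bound the two
components. -/
lemma norm_rotorParam_sub_le (a : E3) : ‖rotorParam a - (1, 0)‖ ≤ ‖a‖ := by
  refine max_le ?_ ?_
  · have h := Real.abs_sin_le_one (‖a‖ / 2 / 2)
    have h1 : Real.cos (‖a‖ / 2) - 1 = -(2 * Real.sin (‖a‖ / 4) ^ 2) := by
      have := Real.cos_sq' (‖a‖ / 4)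
      have h2 := Real.cos_two_mul (‖a‖ / 4)
      rw [show 2 * (‖a‖ / 4) = ‖a‖ / 2 by ring] at h2
      linarith
    have h3 : |Real.sin (‖a‖ / 4)| ≤ |‖a‖ / 4| := Real.abs_sin_le_abs
    rw [abs_of_nonneg (by positivity : 0 ≤ ‖a‖ / 4)] at h3
    have h4 := Real.abs_sin_le_one (‖a‖ / 4)
    simp only [rotorParam, Prod.fst_sub, Real.norm_eq_abs]
    rw [h1, abs_neg, abs_of_nonneg (by positivity), ← sq_abs]
    nlinarith [abs_nonneg (Real.sin (‖a‖ / 4)), norm_nonneg a]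
  · have h3 : |Real.sin (‖a‖ / 2)| ≤ |‖a‖ / 2| := Real.abs_sin_le_abs
    rw [abs_of_nonneg (by positivity : 0 ≤ ‖a‖ / 2)] at h3
    simp only [rotorParam, Prod.snd_sub, sub_zero]
    rw [norm_sinc_smul]
    linarith

set_option maxSynthPendingDepth 3 in
/-- The thrust-direction error vanishes at least linearly with the angular error. -/
lemma exists_norm_thrustError_le :
    ∃ C : ℝ, 0 ≤ C ∧ ∀ a v : E3, ‖thrustError a v‖ ≤ C * ‖a‖ * ‖v‖ := by
  -- Telescoping: `R v R† - v = (R - 1) v R† + v (R - 1)†`. The constant is `3 = 2 + 1`, from the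
  -- bounds `2` on the parameters of `R` and `1` on those of the unit.
  refine ⟨‖sandwich‖ * 3, by positivity, fun a v => ?_⟩
  have h : thrustError a v = sandwich (rotorParam a - (1, 0)) (rotorParam a) v +
      sandwich (1, 0) (rotorParam a - (1, 0)) v := by
    rw [thrustError, rotate_eq]
    conv_lhs => rw [← sandwich_one_one v]
    simp only [map_sub, sub_apply, sandwich_one_one]
    abel
  have hop : ∀ p q : ℝ × E3, ‖sandwich p q v‖ ≤ ‖sandwich‖ * ‖p‖ * ‖q‖ * ‖v‖ := fun p q =>
    (ContinuousLinearMap.le_opNorm _ _).trans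
      (mul_le_mul_of_nonneg_right (ContinuousLinearMap.le_opNorm₂ _ _ _) (norm_nonneg v))
  have h1 : ‖((1, 0) : ℝ × E3)‖ ≤ 1 := by simp [Prod.norm_def]
  have h2 := norm_rotorParam_le a
  have h3 := norm_rotorParam_sub_le a
  rw [h]
  calc _ ≤ ‖sandwich‖ * ‖rotorParam a - (1, 0)‖ * ‖rotorParam a‖ * ‖v‖ +
        ‖sandwich‖ * ‖((1, 0) : ℝ × E3)‖ * ‖rotorParam a - (1, 0)‖ * ‖v‖ :=
        (norm_add_le _ _).trans (add_le_add (hop _ _) (hop _ _))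
    _ ≤ ‖sandwich‖ * ‖a‖ * 2 * ‖v‖ + ‖sandwich‖ * 1 * ‖a‖ * ‖v‖ := by gcongr
    _ = _ := by ring

lemma continuous_thrustError : Continuous fun p : E3 × E3 => thrustError p.1 p.2 := by
  simp only [thrustError, rotate_eq]
  have h : Continuous fun p : E3 × E3 => rotorParam p.1 :=
    continuous_rotorParam.comp continuous_fst
  have h2 : Continuous fun p : E3 × E3 => sandwich (rotorParam p.1) (rotorParam p.1) :=
    (sandwich.continuous.comp h).clm_apply h
  exact (h2.clm_apply continuous_snd).sub continuous_snd


/-! ### Exponential decay of Hurwitz flows -/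

section Hurwitz

variable {p : Type} [Fintype p] [DecidableEq p]

open scoped Matrix.Norms.Operator in
/-- The eigenvalues of `exp M` are the exponentials of eigenvalues of `M`. -/
lemma exists_exp_eq_of_mem_spectrum_exp {M : Matrix p p ℂ} {z : ℂ}
    (hz : z ∈ spectrum ℂ (NormedSpace.exp M)) : ∃ μ ∈ spectrum ℂ M, Complex.exp μ = z := by
  set T := Matrix.toLinAlgEquiv' (NormedSpace.exp M) with hT
  set S := Matrix.toLinAlgEquiv' M with hS
  have hcomm : Commute T S := (Commute.refl M).exp_left.map Matrix.toLinAlgEquiv'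
  have hTz : Module.End.HasEigenvalue T z := by
    rw [Module.End.hasEigenvalue_iff_mem_spectrum, hT, AlgEquiv.spectrum_eq]
    exact hz
  -- `M` commutes with `exp M`, so it preserves the `z`-eigenspace of `exp M` and has an eigenvector
  -- `v` there. Evaluating the exponential series at `v` gives `exp μ • v = z • v`.
  have hmaps := Module.End.mapsTo_genEigenspace_of_comm hcomm z 1
  have : Nontrivial (Module.End.eigenspace T z) :=
    Submodule.nontrivial_iff_ne_bot.2 hTz
  obtain ⟨μ, hμ⟩ := Module.End.exists_eigenvalue
    (S.restrict (p := Module.End.eigenspace T z) (q := Module.End.eigenspace T z) hmaps)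
  obtain ⟨v, hv⟩ := hμ.exists_hasEigenvector
  have hv0 : (v : p → ℂ) ≠ 0 := fun h => hv.2 (Subtype.ext h)
  have hSv : S v = μ • (v : p → ℂ) := congrArg Subtype.val hv.apply_eq_smul
  have hTv : T v = z • (v : p → ℂ) := Module.End.mem_eigenspace_iff.1 v.2
  refine ⟨μ, ?_, ?_⟩
  · rw [← AlgEquiv.spectrum_eq Matrix.toLinAlgEquiv' M]
    exact (Module.End.hasEigenvalue_of_hasEigenvector
      ⟨Module.End.mem_eigenspace_iff.2 hSv, hv0⟩).mem_spectrum
  · let ev : Matrix p p ℂ →ₗ[ℂ] p → ℂ :=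
      LinearMap.applyₗ (v : p → ℂ) ∘ₗ Matrix.toLinAlgEquiv'.toLinearMap
    have hev : Continuous ev := ev.continuous_of_finiteDimensional
    have h1 : HasSum (fun n : ℕ => ev ((n.factorial : ℂ)⁻¹ • M ^ n)) (ev (NormedSpace.exp M)) :=
      (NormedSpace.exp_series_hasSum_exp' (𝕂 := ℂ) M).map ev hev
    have hpow : ∀ n : ℕ, ev (M ^ n) = μ ^ n • (v : p → ℂ) := by
      intro n
      have hn : ∀ n : ℕ, (S ^ n) v = μ ^ n • (v : p → ℂ) := by
        intro n
        induction n with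
        | zero => simp
        | succ n ih =>
          rw [pow_succ, Module.End.mul_apply, hSv, map_smul, ih, smul_smul, pow_succ, mul_comm]
      rw [← hn n, hS, ← map_pow]
      rfl
    have h2 := (NormedSpace.exp_series_hasSum_exp' (𝕂 := ℂ) μ).smul_const (v : p → ℂ)
    have h3 : ev (NormedSpace.exp M) = NormedSpace.exp μ • (v : p → ℂ) := by
      refine h1.unique ?_
      convert! h2 using 2 with n
      rw [map_smul, hpow, smul_assoc]
    have h4 : NormedSpace.exp μ • (v : p → ℂ) = z • (v : p → ℂ) := h3.symm.trans hTv
    rw [Complex.exp_eq_exp_ℂ]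
    exact smul_left_injective ℂ hv0 h4

/-- In a complex Banach algebra, powers of an element of spectral radius below one vanish. -/
lemma tendsto_pow_of_spectrum {A : Type*} [NormedRing A] [NormedAlgebra ℂ A] [CompleteSpace A]
    {a : A} (h : ∀ z ∈ spectrum ℂ a, ‖z‖ < 1) : Tendsto (fun n : ℕ => a ^ n) atTop (𝓝 0) := by
  rcases subsingleton_or_nontrivial A with hA | hA
  · exact tendsto_const_nhds.congr fun n => Subsingleton.elim _ _
  obtain ⟨z, hz, hz'⟩ :=
    spectrum.exists_nnnorm_eq_spectralRadius_of_nonempty (spectrum.nonempty a)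
  obtain ⟨r, hzr, hr⟩ := exists_between (show ‖z‖₊ < 1 from h z hz)
  -- Gelfand's formula: eventually `‖a ^ n‖ ≤ r ^ n` for an `r < 1` above the spectral radius.
  have hlim := spectrum.pow_nnnorm_pow_one_div_tendsto_nhds_spectralRadius a
  have hev := hlim.eventually_lt_const (u := (r : ENNReal)) (hz' ▸ ENNReal.coe_lt_coe.2 hzr)
  refine squeeze_zero_norm' (a := fun n : ℕ => (r : ℝ) ^ n) ?_
    (tendsto_pow_atTop_nhds_zero_of_lt_one r.2 hr)
  filter_upwards [hev, eventually_gt_atTop 0] with n hn hn0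
  have h1 := ENNReal.rpow_lt_rpow hn (show (0 : ℝ) < n by exact_mod_cast hn0)
  rw [← ENNReal.rpow_mul, one_div_mul_cancel (by positivity), ENNReal.rpow_one,
    ENNReal.rpow_natCast] at h1
  exact_mod_cast h1.le

/-- A real Banach algebra element whose exponential flow contracts at one time decays. -/
lemma exists_norm_exp_smul_le {A : Type*} [NormedRing A] [NormedAlgebra ℝ A] [CompleteSpace A]
    {a : A} {T : ℝ} (hT : 0 < T) (h : ‖NormedSpace.exp (T • a)‖ < 1) :
    ∃ k l : ℝ, 0 < k ∧ 0 < l ∧ ∀ t : ℝ, 0 ≤ t →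
      ‖NormedSpace.exp (t • a)‖ ≤ k * Real.exp (-(l * t)) := by
  have hcont : Continuous fun t : ℝ => NormedSpace.exp (t • a) :=
    continuous_iff_continuousAt.2 fun t => (hasDerivAt_exp_smul_const a t).continuousAt
  obtain ⟨K, hK⟩ := (isCompact_Icc (a := (0 : ℝ)) (b := T)).exists_bound_of_continuousOn
    hcont.continuousOn
  -- The maximum with `0` keeps `q` positive, so that `log q` is meaningful even if the norm
  -- vanishes.
  obtain ⟨q, hq, hq1⟩ := exists_between (max_lt h one_pos)
  have hq0 : 0 < q := (le_max_right _ _).trans_lt hq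
  have hl : 0 < -Real.log q / T := div_pos (neg_pos.2 (Real.log_neg hq0 hq1)) hT
  set l := -Real.log q / T with hl_def
  refine ⟨(|K| + 1) * Real.exp (l * T), l, by positivity, hl, fun t ht => ?_⟩
  set m := ⌊t / T⌋₊ with hm
  have hm1 : m * T ≤ t := (le_div_iff₀ hT).1 (Nat.floor_le (by positivity))
  have hm2 : t < (m + 1) * T := (div_lt_iff₀ hT).1 (Nat.lt_floor_add_one _)
  have hs : t - m * T ∈ Icc 0 T := ⟨by linarith, by linarith⟩
  have hsplit : NormedSpace.exp (t • a) =
      NormedSpace.exp (T • a) ^ m * NormedSpace.exp ((t - m * T) • a) := by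
    let := NormedAlgebra.restrictScalars ℚ ℝ A
    rw [← NormedSpace.exp_nsmul, ← NormedSpace.exp_add_of_commute]
    · congr 1
      module
    · exact (((Commute.refl a).smul_left _).smul_left _).smul_right _
  have hqm : ‖NormedSpace.exp (T • a) ^ m * NormedSpace.exp ((t - m * T) • a)‖ ≤
      q ^ m * (|K| + 1) := by
    have h2 : ‖NormedSpace.exp ((t - m * T) • a)‖ ≤ |K| + 1 :=
      (hK _ hs).trans ((le_abs_self K).trans (by linarith))
    have h3 : ‖NormedSpace.exp (T • a)‖ ≤ q := (le_max_left _ _).trans hq.le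
    -- `‖1‖ = 1` is not assumed, so the empty power is treated apart.
    rcases Nat.eq_zero_or_pos m with h0 | h0
    · simpa [h0] using h2
    · exact (norm_mul_le _ _).trans (mul_le_mul
        ((norm_pow_le' _ h0).trans (pow_le_pow_left₀ (norm_nonneg _) h3 _)) h2
        (norm_nonneg _) (by positivity))
  rw [hsplit]
  refine hqm.trans ?_
  have hqe : q ^ m ≤ Real.exp (l * T) * Real.exp (-(l * t)) := by
    rw [← Real.exp_add, ← Real.exp_log hq0, ← Real.exp_nat_mul]
    refine Real.exp_le_exp.2 ?_
    have : Real.log q = -(l * T) := by rw [hl_def]; field_simp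
    rw [this]
    nlinarith
  calc q ^ m * (|K| + 1) ≤ Real.exp (l * T) * Real.exp (-(l * t)) * (|K| + 1) := by gcongr
    _ = _ := by ring

open scoped Matrix.Norms.Operator in
/-- The linear flow of a Hurwitz matrix decays exponentially. -/
lemma IsHurwitz.exists_norm_exp_le {M : Matrix p p ℝ} (hM : IsHurwitz M) :
    ∃ k l : ℝ, 0 < k ∧ 0 < l ∧ ∀ t : ℝ, 0 ≤ t →
      ‖NormedSpace.exp (t • Matrix.toEuclideanCLM (𝕜 := ℝ) M)‖ ≤ k * Real.exp (-(l * t)) := by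
  have h1 : Tendsto (fun n : ℕ => NormedSpace.exp (M.map (algebraMap ℝ ℂ)) ^ n) atTop (𝓝 0) := by
    refine tendsto_pow_of_spectrum fun z hz => ?_
    obtain ⟨μ, hμ, rfl⟩ := exists_exp_eq_of_mem_spectrum_exp hz
    rw [Complex.norm_exp]
    exact Real.exp_zero ▸ Real.exp_lt_exp.2 (hM μ hμ)
  have hmapc : Continuous ((algebraMap ℝ ℂ).mapMatrix : Matrix p p ℝ →+* Matrix p p ℂ) :=
    Continuous.matrix_map continuous_id Complex.continuous_ofReal
  have h2 : ∀ n : ℕ, NormedSpace.exp (M.map (algebraMap ℝ ℂ)) ^ n =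
      (NormedSpace.exp M ^ n).map (algebraMap ℝ ℂ) := by
    intro n
    have : NormedSpace.exp (M.map (algebraMap ℝ ℂ)) =
        (NormedSpace.exp M).map (algebraMap ℝ ℂ) :=
      (NormedSpace.map_exp (algebraMap ℝ ℂ).mapMatrix hmapc M).symm
    rw [this]
    exact (map_pow (algebraMap ℝ ℂ).mapMatrix (NormedSpace.exp M) n).symm
  have h3 : Tendsto (fun n : ℕ => NormedSpace.exp M ^ n) atTop (𝓝 0) := by
    -- The spectral argument lives over `ℂ`; since the powers have real entries, real parts carry
    -- the limit back to `ℝ`.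
    have hre : Continuous fun N : Matrix p p ℂ => N.map Complex.re :=
      Continuous.matrix_map continuous_id Complex.continuous_re
    have := (hre.tendsto 0).comp h1
    convert! this using 1
    · ext n i j
      rw [Function.comp_apply, h2, Matrix.map_apply, Matrix.map_apply]
      rfl
  let e : Matrix p p ℝ →ₗ[ℝ] EuclideanSpace ℝ p →L[ℝ] EuclideanSpace ℝ p :=
    (Matrix.toEuclideanCLM (𝕜 := ℝ) (n := p)).toAlgEquiv.toLinearMap
  have he : Continuous e := e.continuous_of_finiteDimensional
  have h4 := (he.tendsto 0).comp h3
  rw [map_zero] at h4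
  -- Some power of `exp M` is a strict contraction in the Euclidean operator norm. It is the flow at
  -- time `n`, and contraction at one time suffices.
  obtain ⟨n, hn, hn0⟩ := ((h4.norm.eventually_lt_const (u := 1) (by simp)).and
    (eventually_gt_atTop 0)).exists
  refine exists_norm_exp_smul_le (A := EuclideanSpace ℝ p →L[ℝ] EuclideanSpace ℝ p)
    (T := n) (by exact_mod_cast hn0) (lt_of_eq_of_lt ?_ hn)
  congr 1
  let := NormedAlgebra.restrictScalars ℚ ℝ (EuclideanSpace ℝ p →L[ℝ] EuclideanSpace ℝ p)
  rw [Nat.cast_smul_eq_nsmul, NormedSpace.exp_nsmul, Function.comp_apply]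
  show _ = Matrix.toEuclideanCLM (𝕜 := ℝ) (NormedSpace.exp M ^ n)
  rw [map_pow]
  congr 1
  exact (NormedSpace.map_exp (Matrix.toEuclideanCLM (𝕜 := ℝ) (n := p)) he M).symm

end Hurwitz


/-! ### Variation of constants for integrable forcing terms -/

section VariationOfConstants

variable {E F : Type*} [NormedAddCommGroup E] [NormedSpace ℝ E] [NormedAddCommGroup F]
  [NormedSpace ℝ F]

lemma intervalIntegrable_clm_apply {Φ : ℝ → E →L[ℝ] F} (hΦ : Continuous Φ) {f : ℝ → E} {a b : ℝ}
    (hf : IntervalIntegrable f volume a b) :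
    IntervalIntegrable (fun s => Φ s (f s)) volume a b := by
  obtain ⟨K, hK⟩ := (isCompact_uIcc (a := a) (b := b)).exists_bound_of_continuousOn
    hΦ.continuousOn
  refine (hf.norm.const_mul K).mono_fun ?_ ?_
  · exact isBoundedBilinearMap_apply.continuous.comp_aestronglyMeasurable
      (hΦ.aestronglyMeasurable.prodMk hf.def'.aestronglyMeasurable)
  · refine (ae_restrict_mem measurableSet_uIoc).mono fun s hs => ?_
    have h1 := hK s (uIoc_subset_uIcc hs)
    have h2 : ‖Φ s (f s)‖ ≤ K * ‖f s‖ :=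
      (ContinuousLinearMap.le_opNorm _ _).trans (mul_le_mul_of_nonneg_right h1 (norm_nonneg _))
    exact h2.trans (le_abs_self _)

/-- A function that is an indefinite integral on an interval is continuous there. -/
lemma continuousOn_of_eq_integral {f X : ℝ → E} {a b : ℝ} (hab : a ≤ b)
    (hf : IntervalIntegrable f volume a b)
    (hX : ∀ t ∈ Icc a b, X t = X a + ∫ s in a..t, f s) : ContinuousOn X (Icc a b) := by
  refine ContinuousOn.congr ?_ hX
  have := intervalIntegral.continuousOn_primitive_interval'
    hf (left_mem_uIcc (a := a) (b := b))
  rw [uIcc_of_le hab] at this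
  exact continuousOn_const.add this

/-- Strict differentiability makes `Φ` Lipschitz near `t`, so the integral is at most `K |s - t| |∫
‖f‖|`, which is `o(s - t)` although `f` is only integrable. This is the remainder in the product
rule below. -/
lemma hasDerivAt_integral_sub_clm_apply {Φ Φ' : ℝ → E →L[ℝ] F}
    (hΦ : ∀ t, HasStrictDerivAt Φ (Φ' t) t) {f : ℝ → E} (hf : Integrable f) (t : ℝ) :
    HasDerivAt (fun s => ∫ r in t..s, (Φ s - Φ r) (f r)) 0 t := by
  obtain ⟨K, U, hU, hK⟩ := (hΦ t).hasStrictFDerivAt.exists_lipschitzOnWith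
  obtain ⟨ε, hε, hball⟩ := Metric.mem_nhds_iff.1 hU
  rw [hasDerivAt_iff_isLittleO]
  simp only [intervalIntegral.integral_same, sub_zero, smul_zero]
  have hbound : ∀ᶠ s in 𝓝 t, ‖∫ r in t..s, (Φ s - Φ r) (f r)‖ ≤
      (K : ℝ) * ‖|∫ r in t..s, ‖f r‖| * (s - t)‖ := by
    filter_upwards [Metric.ball_mem_nhds t hε] with s hs
    have h1 : ∀ᵐ r ∂volume.restrict (uIoc t s), ‖(Φ s - Φ r) (f r)‖ ≤
        (K * |s - t|) * ‖f r‖ := by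
      refine (ae_restrict_mem measurableSet_uIoc).mono fun r hr => ?_
      have hr' : r ∈ uIcc t s := uIoc_subset_uIcc hr
      have hrt : |s - r| ≤ |s - t| := by
        exact abs_sub_right_of_mem_uIcc hr'
      have hrb : r ∈ Metric.ball t ε :=
        (convex_ball t ε).ordConnected.uIcc_subset (Metric.mem_ball_self hε) hs hr'
      have h2 : ‖Φ s - Φ r‖ ≤ K * |s - t| := by
        have := hK.dist_le_mul s (hball hs) r (hball hrb)
        rw [dist_eq_norm, Real.dist_eq] at this
        exact this.trans (mul_le_mul_of_nonneg_left hrt K.2)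
      exact (ContinuousLinearMap.le_opNorm _ _).trans
        (mul_le_mul_of_nonneg_right h2 (norm_nonneg _))
    refine (intervalIntegral.norm_integral_le_abs_of_norm_le h1
      ((hf.norm.intervalIntegrable).const_mul _)).trans_eq ?_
    rw [intervalIntegral.integral_const_mul, norm_mul, Real.norm_eq_abs, Real.norm_eq_abs,
      abs_abs, abs_mul, abs_mul, abs_abs, NNReal.abs_eq]
    ring
  refine (Asymptotics.IsBigO.of_bound _ hbound).trans_isLittleO ?_
  have hlim : Tendsto (fun s => |∫ r in t..s, ‖f r‖|) (𝓝 t) (𝓝 0) := by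
    have hc := intervalIntegral.continuous_primitive
      (fun a b => hf.norm.intervalIntegrable (a := a) (b := b)) t
    simpa using (hc.tendsto t).abs
  have := ((Asymptotics.isLittleO_one_iff ℝ).2 hlim).mul_isBigO
    (Asymptotics.isBigO_refl (fun s : ℝ => s - t) (𝓝 t))
  simpa using this

variable [CompleteSpace E] [CompleteSpace F]

/-- Product rule for a continuously differentiable family of operators applied to an indefinite
integral. -/
lemma integral_clm_apply_eq_sub {Φ Φ' : ℝ → E →L[ℝ] F}
    (hΦ : ∀ t, HasStrictDerivAt Φ (Φ' t) t) (hΦ' : Continuous Φ') {f X : ℝ → E} {a b : ℝ}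
    (hab : a ≤ b) (hf : IntervalIntegrable f volume a b)
    (hX : ∀ t ∈ Icc a b, X t = X a + ∫ s in a..t, f s) :
    ∫ s in a..b, (Φ' s (X s) + Φ s (f s)) = Φ b (X b) - Φ a (X a) := by
  have hΦc : Continuous Φ := continuous_iff_continuousAt.2 fun t => (hΦ t).hasDerivAt.continuousAt
  -- Truncation makes the forcing integrable on the whole line, so that derivatives at the endpoints
  -- need no special treatment.
  set g : ℝ → E := (Ioc a b).indicator f with hg
  have hgi : Integrable g :=
    (integrable_indicator_iff measurableSet_Ioc).2 ((intervalIntegrable_iff_integrableOn_Ioc_of_le hab).1 hf)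
  have hgf : ∀ s ∈ Ioc a b, g s = f s := fun s hs => indicator_of_mem hs f
  set Y : ℝ → E := fun t => X a + ∫ s in a..t, g s with hY
  have hYc : Continuous Y := continuous_const.add
    (intervalIntegral.continuous_primitive (fun _ _ => hgi.intervalIntegrable) a)
  have hYX : ∀ t ∈ Icc a b, Y t = X t := by
    intro t ht
    rw [hX t ht]
    refine congrArg (X a + ·) (intervalIntegral.integral_congr_ae (ae_of_all _ fun s hs => ?_))
    rw [uIoc_of_le ht.1] at hs
    exact hgf s ⟨hs.1, hs.2.trans ht.2⟩
  have hgΦ : ∀ c d, IntervalIntegrable (fun s => Φ s (g s)) volume c d := fun c d =>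
    intervalIntegrable_clm_apply hΦc hgi.intervalIntegrable
  -- Neither term need be differentiable everywhere, but the difference is: near `t` it equals `Φ s
  -- (Y t)` minus a constant, plus the remainder of zero derivative.
  have hderiv : ∀ t, HasDerivAt (fun s => Φ s (Y s) - ∫ r in a..s, Φ r (g r))
      (Φ' t (Y t)) t := by
    intro t
    have h1 : HasDerivAt (fun s => Φ s (Y t) - ∫ r in a..t, Φ r (g r)) (Φ' t (Y t)) t := by
      have := ((hΦ t).hasDerivAt.clm_apply (hasDerivAt_const t (Y t))).sub_const
        (∫ r in a..t, Φ r (g r))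
      simpa using this
    have h2 := h1.add (hasDerivAt_integral_sub_clm_apply hΦ hgi t)
    rw [add_zero] at h2
    refine h2.congr_of_eventuallyEq (Eventually.of_forall fun s => ?_)
    have h3 : Y s = Y t + ∫ r in t..s, g r := by
      simp only [hY]
      rw [add_assoc, intervalIntegral.integral_add_adjacent_intervals
        hgi.intervalIntegrable hgi.intervalIntegrable]
    have h4 : ∫ r in t..s, (Φ s - Φ r) (g r) =
        Φ s (∫ r in t..s, g r) - ∫ r in t..s, Φ r (g r) := by
      rw [← ContinuousLinearMap.intervalIntegral_comp_comm _ hgi.intervalIntegrable,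
        ← intervalIntegral.integral_sub _ (hgΦ t s)]
      · rfl
      · exact intervalIntegrable_clm_apply continuous_const hgi.intervalIntegrable
    have h5 := intervalIntegral.integral_add_adjacent_intervals (hgΦ a t) (hgΦ t s)
    simp only [Pi.add_apply]
    rw [h4, h3, map_add, ← h5]
    abel
  have hΦ'Y : IntervalIntegrable (fun s => Φ' s (Y s)) volume a b :=
    (hΦ'.clm_apply hYc).intervalIntegrable _ _
  have hFTC := intervalIntegral.integral_eq_sub_of_hasDerivAt (fun t _ => hderiv t) hΦ'Y
  have hcongr : ∫ s in a..b, (Φ' s (X s) + Φ s (f s)) =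
      ∫ s in a..b, (Φ' s (Y s) + Φ s (g s)) := by
    refine intervalIntegral.integral_congr_ae (ae_of_all _ fun s hs => ?_)
    rw [uIoc_of_le hab] at hs
    rw [hgf s hs, hYX s (Ioc_subset_Icc_self hs)]
  rw [hcongr, intervalIntegral.integral_add hΦ'Y (hgΦ a b), hFTC,
    hYX a (left_mem_Icc.2 hab), hYX b (right_mem_Icc.2 hab), intervalIntegral.integral_same]
  abel

lemma hasStrictDerivAt_exp_sub_smul (L : E →L[ℝ] E) (b t : ℝ) :
    HasStrictDerivAt (fun s : ℝ => NormedSpace.exp ((b - s) • L))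
      (-(NormedSpace.exp ((b - t) • L) * L)) t := by
  have h1 : HasStrictDerivAt (fun s : ℝ => b - s) (-1) t := by
    simpa using (hasStrictDerivAt_id t).const_sub b
  have h2 := HasStrictDerivAt.scomp t (hasStrictDerivAt_exp_smul_const (𝕂 := ℝ) L (b - t)) h1
  rw [neg_one_smul] at h2
  exact h2

lemma continuous_exp_sub_smul (L : E →L[ℝ] E) (b : ℝ) :
    Continuous fun s : ℝ => NormedSpace.exp ((b - s) • L) :=
  continuous_iff_continuousAt.2 fun t => (hasStrictDerivAt_exp_sub_smul L b t).hasDerivAt.continuousAt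

/-- Variation of constants for Carathéodory solutions of `ẋ = L x + q`. -/
lemma eq_exp_add_integral {L : E →L[ℝ] E} {q X : ℝ → E} {a b : ℝ} (hab : a ≤ b)
    (hq : IntervalIntegrable q volume a b) (hXc : ContinuousOn X (Icc a b))
    (hX : ∀ t ∈ Icc a b, X t = X a + ∫ s in a..t, (L (X s) + q s)) :
    X b = NormedSpace.exp ((b - a) • L) (X a) +
      ∫ s in a..b, NormedSpace.exp ((b - s) • L) (q s) := by
  have hLX : IntervalIntegrable (fun s => L (X s)) volume a b := by
    refine ContinuousOn.intervalIntegrable ?_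
    rw [uIcc_of_le hab]
    exact L.continuous.comp_continuousOn hXc
  have h := integral_clm_apply_eq_sub (hasStrictDerivAt_exp_sub_smul L b)
    ((continuous_exp_sub_smul L b).mul continuous_const).neg hab (hLX.add hq) hX
  simp only [sub_self, zero_smul, NormedSpace.exp_zero, one_apply_eq_self] at h
  rw [← sub_eq_iff_eq_add', ← h]
  refine intervalIntegral.integral_congr fun s _ => ?_
  simp

end VariationOfConstants

/-! ### A Gronwall estimate for cascades with exponentially decaying coupling -/

/-- With `e = exp (-(l (t - a)))` and `D` equal to `h₀` plus the integral, the hypothesis reads `v ≤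
e D + M`, hence `D' ≤ ρ e² D + ρ (1 + M) e`. Both coefficients have finite integral over all time,
so `D` stays bounded uniformly in `b - a`. -/
lemma cascade_gronwall {v : ℝ → ℝ} {a b l ρ h₀ M : ℝ} (hab : a ≤ b) (hl : 0 < l) (hρ : 0 ≤ ρ)
    (hM : 0 ≤ M) (hv : ContinuousOn v (Icc a b))
    (h : ∀ t ∈ Icc a b, Real.exp (l * (t - a)) * v t ≤
      h₀ + (∫ s in a..t, ρ * Real.exp (-(l * (s - a))) * (1 + v s)) +
        M * Real.exp (l * (t - a))) :
    v b ≤ Real.exp (-(l * (b - a))) * Real.exp (ρ / (2 * l)) * (|h₀| + ρ * (1 + M) / l) + M := by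
  set p : ℝ → ℝ := fun s => ρ * Real.exp (-(l * (s - a))) * (1 + v s) with hp
  have hpc : ContinuousOn p (Icc a b) := by fun_prop
  set D : ℝ → ℝ := fun t => h₀ + ∫ s in a..t, p s with hD
  -- `P` is the primitive of `ρ e²` and gives the integrating factor. The last term of `Z` absorbs
  -- `ρ (1 + M) e`, which makes `Z` nonincreasing.
  set P : ℝ → ℝ := fun t => ρ / (2 * l) * (1 - Real.exp (-(2 * l * (t - a)))) with hP
  set Z : ℝ → ℝ := fun t => D t * Real.exp (-P t) + ρ * (1 + M) / l * Real.exp (-(l * (t - a)))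
    with hZ
  have hpi : IntervalIntegrable p volume a b := by
    refine ContinuousOn.intervalIntegrable ?_
    rwa [uIcc_of_le hab]
  have hDc : ContinuousOn D (Icc a b) :=
    continuousOn_of_eq_integral (f := p) hab hpi fun t _ => by simp [hD]
  have hZc : ContinuousOn Z (Icc a b) := by fun_prop
  have hDd : ∀ t ∈ Ioo a b, HasDerivAt D (p t) t := by
    intro t ht
    refine HasDerivAt.const_add _ (intervalIntegral.integral_hasDerivAt_right ?_ ?_ ?_)
    · exact hpi.mono_set (by
        rw [uIcc_of_le hab, uIcc_of_le ht.1.le]; exact Icc_subset_Icc_right ht.2.le)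
    · exact (hpc.mono Ioo_subset_Icc_self).stronglyMeasurableAtFilter isOpen_Ioo t ht
    · exact hpc.continuousAt (Icc_mem_nhds ht.1 ht.2)
  have hexpd : ∀ c t : ℝ, HasDerivAt (fun t => Real.exp (-(c * (t - a))))
      (-c * Real.exp (-(c * (t - a)))) t := by
    intro c t
    have h1 : HasDerivAt (fun t => -(c * (t - a))) (-(c * 1)) t :=
      (((hasDerivAt_id t).sub_const a).const_mul c).neg
    convert! h1.exp using 1
    ring
  have hPd : ∀ t, HasDerivAt P (ρ * Real.exp (-(2 * l * (t - a)))) t := by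
    intro t
    convert! ((hexpd (2 * l) t).const_sub 1).const_mul (ρ / (2 * l)) using 1
    field_simp
  have hP0 : ∀ t ∈ Icc a b, 0 ≤ P t := by
    intro t ht
    have : Real.exp (-(2 * l * (t - a))) ≤ 1 :=
      Real.exp_le_one_iff.2 (neg_nonpos.2 (mul_nonneg (by positivity) (sub_nonneg.2 ht.1)))
    exact mul_nonneg (by positivity) (by linarith)
  have hPle : ∀ t, P t ≤ ρ / (2 * l) := fun t => by
    have := Real.exp_pos (-(2 * l * (t - a)))
    exact mul_le_of_le_one_right (by positivity) (by linarith)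
  have hZd : ∀ t ∈ Ioo a b, HasDerivAt Z
      (p t * Real.exp (-P t) + D t * (Real.exp (-P t) * -(ρ * Real.exp (-(2 * l * (t - a))))) +
        ρ * (1 + M) / l * (-l * Real.exp (-(l * (t - a))))) t := fun t ht =>
    ((hDd t ht).mul (hPd t).neg.exp).add ((hexpd l t).const_mul _)
  have hanti : AntitoneOn Z (Icc a b) := by
    refine antitoneOn_of_deriv_nonpos (convex_Icc a b) hZc ?_ ?_
    · rw [interior_Icc]
      exact fun t ht => (hZd t ht).differentiableAt.differentiableWithinAt
    · rw [interior_Icc]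
      intro t ht
      rw [(hZd t ht).deriv]
      have ht' := Ioo_subset_Icc_self ht
      have h1 := h t ht'
      set e := Real.exp (-(l * (t - a))) with he
      have he0 : 0 < e := Real.exp_pos _
      have hee : Real.exp (-(2 * l * (t - a))) = e * e := by
        rw [he, ← Real.exp_add]; congr 1; ring
      have hinv : Real.exp (l * (t - a)) * e = 1 := by
        rw [he, ← Real.exp_add, add_neg_cancel, Real.exp_zero]
      have h2 : v t ≤ e * D t + M := by
        have := mul_le_mul_of_nonneg_left h1 he0.le
        calc v t = e * (Real.exp (l * (t - a)) * v t) := by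
              rw [← mul_assoc, mul_comm e, hinv, one_mul]
          _ ≤ _ := this
          _ = e * D t + M * (Real.exp (l * (t - a)) * e) := by ring
          _ = _ := by rw [hinv, mul_one]
      have hq1 : Real.exp (-P t) ≤ 1 := Real.exp_le_one_iff.2 (neg_nonpos.2 (hP0 t ht'))
      have hq0 := Real.exp_pos (-P t)
      set q := Real.exp (-P t)
      have h3 : p t ≤ ρ * e * (1 + (e * D t + M)) := by
        simp only [hp]
        gcongr
      have h4 : ρ * (1 + M) / l * (-l * e) = -(ρ * (1 + M) * e) := by field_simp
      rw [hee, h4]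
      have h5 : p t * q ≤ ρ * e * (1 + (e * D t + M)) * q := mul_le_mul_of_nonneg_right h3 hq0.le
      have h6 : ρ * (1 + M) * e * q ≤ ρ * (1 + M) * e * 1 :=
        mul_le_mul_of_nonneg_left hq1 (by positivity)
      linarith
  have hZab := hanti (left_mem_Icc.2 hab) (right_mem_Icc.2 hab) hab
  have hZa : Z a = h₀ + ρ * (1 + M) / l := by simp [hZ, hD, hP]
  have hb := h b (right_mem_Icc.2 hab)
  have hDb : D b ≤ Real.exp (ρ / (2 * l)) * (|h₀| + ρ * (1 + M) / l) := by
    have h1 : D b * Real.exp (-P b) ≤ |h₀| + ρ * (1 + M) / l := by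
      have h0 : 0 ≤ ρ * (1 + M) / l * Real.exp (-(l * (b - a))) := by positivity
      have h2 := le_abs_self h₀
      rw [hZa] at hZab
      simp only [hZ] at hZab
      linarith
    have h2 : D b = Real.exp (P b) * (D b * Real.exp (-P b)) := by
      rw [mul_comm (D b), ← mul_assoc, ← Real.exp_add, add_neg_cancel, Real.exp_zero, one_mul]
    rw [h2]
    refine (mul_le_mul_of_nonneg_left h1 (Real.exp_pos _).le).trans ?_
    have : Real.exp (P b) ≤ Real.exp (ρ / (2 * l)) := Real.exp_le_exp.2 (hPle b)
    gcongr
  have he0 := Real.exp_pos (-(l * (b - a)))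
  have hinv : Real.exp (-(l * (b - a))) * Real.exp (l * (b - a)) = 1 := by
    rw [← Real.exp_add, neg_add_cancel, Real.exp_zero]
  calc v b = Real.exp (-(l * (b - a))) * (Real.exp (l * (b - a)) * v b) := by
        rw [← mul_assoc, hinv, one_mul]
    _ ≤ Real.exp (-(l * (b - a))) * (D b + M * Real.exp (l * (b - a))) :=
        mul_le_mul_of_nonneg_left hb he0.le
    _ = Real.exp (-(l * (b - a))) * D b +
        M * (Real.exp (-(l * (b - a))) * Real.exp (l * (b - a))) := by ring
    _ ≤ Real.exp (-(l * (b - a))) * (Real.exp (ρ / (2 * l)) * (|h₀| + ρ * (1 + M) / l)) +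
        M * (Real.exp (-(l * (b - a))) * Real.exp (l * (b - a))) := by gcongr
    _ = _ := by rw [hinv]; ring


/-! ### Global existence for globally Lipschitz fields -/

section Existence

variable {E : Type*} [NormedAddCommGroup E]

/-- A weight whose `K`-fold integral is at most half of it, and which dominates `∫ ‖f s 0‖`. -/
def picardWeight (f : ℝ → E → E) (K a t : ℝ) : ℝ :=
  Real.exp (2 * K * (t - a)) * (1 + ∫ s in a..t, ‖f s 0‖)

lemma continuous_picardWeight {f : ℝ → E → E} (hf : Continuous fun t => f t 0) (K a : ℝ) :
    Continuous (picardWeight f K a) := by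
  have : Continuous fun t => ∫ s in a..t, ‖f s 0‖ :=
    intervalIntegral.continuous_primitive (fun _ _ => hf.norm.intervalIntegrable _ _) a
  unfold picardWeight
  fun_prop

lemma one_le_picardWeight {f : ℝ → E → E} {K a t : ℝ} (hK : 0 ≤ K) (ht : a ≤ t) :
    1 ≤ picardWeight f K a t := by
  have h1 : 1 ≤ Real.exp (2 * K * (t - a)) :=
    Real.one_le_exp (mul_nonneg (by positivity) (sub_nonneg.2 ht))
  have h2 : 0 ≤ ∫ s in a..t, ‖f s 0‖ := intervalIntegral.integral_nonneg ht fun _ _ => norm_nonneg _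
  exact one_le_mul_of_one_le_of_one_le h1 (by linarith)

lemma integral_le_picardWeight {f : ℝ → E → E} {K a t : ℝ} (hK : 0 ≤ K) (ht : a ≤ t) :
    ∫ s in a..t, ‖f s 0‖ ≤ picardWeight f K a t := by
  have h1 : 1 ≤ Real.exp (2 * K * (t - a)) :=
    Real.one_le_exp (mul_nonneg (by positivity) (sub_nonneg.2 ht))
  have h2 : 0 ≤ ∫ s in a..t, ‖f s 0‖ := intervalIntegral.integral_nonneg ht fun _ _ => norm_nonneg _
  unfold picardWeight
  nlinarith

/-- The integral inside the weight is monotone in time, so it may be frozen at its final value; the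
exponent `2 * K` then produces the factor `1 / 2`. -/
lemma integral_picardWeight_le {f : ℝ → E → E} (hf : Continuous fun t => f t 0) {K a t : ℝ}
    (hK : 0 ≤ K) (ht : a ≤ t) :
    ∫ s in a..t, K * picardWeight f K a s ≤ picardWeight f K a t / 2 := by
  set G := 1 + ∫ s in a..t, ‖f s 0‖ with hG
  have hmono : ∀ s ∈ Icc a t, K * picardWeight f K a s ≤ K * Real.exp (2 * K * (s - a)) * G := by
    intro s hs
    have h1 : ∫ r in a..s, ‖f r 0‖ ≤ ∫ r in a..t, ‖f r 0‖ :=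
      intervalIntegral.integral_mono_interval le_rfl hs.1 hs.2
        (ae_of_all _ fun _ => norm_nonneg _) (hf.norm.intervalIntegrable _ _)
    have h2 : 1 + ∫ r in a..s, ‖f r 0‖ ≤ G := by linarith
    rw [picardWeight, ← mul_assoc]
    gcongr
  have hd : ∀ s, HasDerivAt (fun s => Real.exp (2 * K * (s - a)) / 2 * G)
      (K * Real.exp (2 * K * (s - a)) * G) s := by
    intro s
    have h1 : HasDerivAt (fun s => 2 * K * (s - a)) (2 * K * 1) s :=
      ((hasDerivAt_id s).sub_const a).const_mul _
    convert! (h1.exp.div_const 2).mul_const G using 1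
    ring
  have hc : Continuous fun s => K * Real.exp (2 * K * (s - a)) * G := by fun_prop
  have hG0 : 0 ≤ G := by
    have : 0 ≤ ∫ s in a..t, ‖f s 0‖ :=
      intervalIntegral.integral_nonneg ht fun _ _ => norm_nonneg _
    linarith
  calc ∫ s in a..t, K * picardWeight f K a s
      ≤ ∫ s in a..t, K * Real.exp (2 * K * (s - a)) * G :=
        intervalIntegral.integral_mono_on ht
          ((continuous_const.mul (continuous_picardWeight hf K a)).intervalIntegrable _ _)
          (hc.intervalIntegrable _ _) hmono
    _ = Real.exp (2 * K * (t - a)) / 2 * G - Real.exp (2 * K * (a - a)) / 2 * G :=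
        intervalIntegral.integral_eq_sub_of_hasDerivAt (fun s _ => hd s)
          (hc.intervalIntegrable _ _)
    _ ≤ Real.exp (2 * K * (t - a)) / 2 * G := by
        have : 0 ≤ Real.exp (2 * K * (a - a)) / 2 * G := by positivity
        linarith
    _ = picardWeight f K a t / 2 := by rw [picardWeight]; ring

variable [NormedSpace ℝ E] [CompleteSpace E]

/-- A continuous field that is globally Lipschitz in the state has global forward solutions. -/
lemma exists_global_solution {f : ℝ → E → E} (hf : Continuous (Function.uncurry f)) {K : ℝ}
    (hK : 0 ≤ K) (hLip : ∀ t x y, ‖f t x - f t y‖ ≤ K * ‖x - y‖) (a : ℝ) (x₀ : E) :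
    ∃ x : ℝ → E, Continuous x ∧ ∀ t, a ≤ t → x t = x₀ + ∫ s in a..t, f s (x s) := by
  have hf0 : Continuous fun t => f t 0 := hf.comp (by fun_prop : Continuous fun t : ℝ => (t, (0 : E)))
  -- Times before `a` are replaced by `a`, so that everything is defined and continuous on `ℝ`.
  set p : ℝ → ℝ := fun t => picardWeight f K a (max t a) with hp
  have hpc : Continuous p := (continuous_picardWeight hf0 K a).comp (by fun_prop)
  have hp1 : ∀ t, 1 ≤ p t := fun t => one_le_picardWeight hK (le_max_right _ _)
  have hp0 : ∀ t, 0 < p t := fun t => one_pos.trans_le (hp1 t)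
  have hint : ∀ y : ℝ → E, Continuous y → Continuous fun s => f s (p s • y s) := fun y hy =>
    hf.comp (continuous_id.prodMk (hpc.smul hy))
  have hpi : ∀ t, ∫ s in a..max t a, K * p s ≤ p t / 2 := by
    intro t
    refine le_trans (le_of_eq ?_) (integral_picardWeight_le hf0 hK (le_max_right t a))
    refine intervalIntegral.integral_congr fun s hs => ?_
    rw [uIcc_of_le (le_max_right t a)] at hs
    simp only [hp, max_eq_left hs.1]
  -- The unknown is `z = x / p`. In this variable the Picard map preserves bounded continuous
  -- functions and halves distances on the whole half-line at once.
  set Ψ : (ℝ → E) → ℝ → E := fun z t =>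
    (p t)⁻¹ • (x₀ + ∫ s in a..max t a, f s (p s • z s)) with hΨ
  have hΨc : ∀ z : BoundedContinuousFunction ℝ E, Continuous (Ψ z) := by
    intro z
    have h1 : Continuous fun t => ∫ s in a..t, f s (p s • z s) :=
      intervalIntegral.continuous_primitive
        (fun _ _ => (hint z z.continuous).intervalIntegrable _ _) a
    have h2 : Continuous fun t => ∫ s in a..max t a, f s (p s • z s) :=
      h1.comp (by fun_prop : Continuous fun t : ℝ => max t a)
    exact (hpc.inv₀ fun t => (hp0 t).ne').smul (continuous_const.add h2)
  have hdiff : ∀ y z : BoundedContinuousFunction ℝ E, ∀ t,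
      ‖∫ s in a..max t a, (f s (p s • y s) - f s (p s • z s))‖ ≤ dist y z * (p t / 2) := by
    intro y z t
    have h1 : ∀ s, ‖f s (p s • y s) - f s (p s • z s)‖ ≤ dist y z * (K * p s) := by
      intro s
      refine (hLip _ _ _).trans ?_
      rw [← smul_sub, norm_smul, Real.norm_of_nonneg (hp0 s).le, ← dist_eq_norm]
      have := y.dist_coe_le_dist (g := z) s
      have h2 := mul_le_mul_of_nonneg_left this (mul_nonneg hK (hp0 s).le)
      linarith
    refine (intervalIntegral.norm_integral_le_of_norm_le (le_max_right t a)
      (ae_of_all _ fun s _ => h1 s)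
      ((continuous_const.mul (continuous_const.mul hpc)).intervalIntegrable _ _)).trans ?_
    rw [intervalIntegral.integral_const_mul]
    exact mul_le_mul_of_nonneg_left (hpi t) dist_nonneg
  have hsub : ∀ y z : BoundedContinuousFunction ℝ E, ∀ t,
      ‖Ψ y t - Ψ z t‖ ≤ dist y z / 2 := by
    intro y z t
    have h1 : Ψ y t - Ψ z t =
        (p t)⁻¹ • ∫ s in a..max t a, (f s (p s • y s) - f s (p s • z s)) := by
      rw [intervalIntegral.integral_sub ((hint y y.continuous).intervalIntegrable _ _)
        ((hint z z.continuous).intervalIntegrable _ _)]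
      simp only [hΨ]
      rw [← smul_sub]
      congr 1
      abel
    rw [h1, norm_smul, norm_inv, Real.norm_of_nonneg (hp0 t).le, inv_mul_le_iff₀ (hp0 t)]
    refine (hdiff y z t).trans_eq ?_
    ring
  have hzero : ∀ t, ‖Ψ (0 : BoundedContinuousFunction ℝ E) t‖ ≤ ‖x₀‖ + 1 := by
    intro t
    simp only [hΨ, BoundedContinuousFunction.coe_zero, Pi.zero_apply, smul_zero]
    rw [norm_smul, norm_inv, Real.norm_of_nonneg (hp0 t).le, inv_mul_le_iff₀ (hp0 t)]
    have h1 : ‖∫ s in a..max t a, f s 0‖ ≤ p t :=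
      (intervalIntegral.norm_integral_le_integral_norm (le_max_right t a)).trans
        (integral_le_picardWeight hK (le_max_right t a))
    have h2 : ‖x₀‖ ≤ p t * ‖x₀‖ := le_mul_of_one_le_left (norm_nonneg _) (hp1 t)
    linarith [norm_add_le x₀ (∫ s in a..max t a, f s 0)]
  have hbd : ∀ z : BoundedContinuousFunction ℝ E, ∀ t, ‖Ψ z t‖ ≤ dist z 0 / 2 + (‖x₀‖ + 1) := by
    intro z t
    calc ‖Ψ z t‖ = ‖(Ψ z t - Ψ (0 : BoundedContinuousFunction ℝ E) t) +
          Ψ (0 : BoundedContinuousFunction ℝ E) t‖ := by rw [sub_add_cancel]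
      _ ≤ _ := (norm_add_le _ _).trans (add_le_add (hsub z 0 t) (hzero t))
  let Φ : BoundedContinuousFunction ℝ E → BoundedContinuousFunction ℝ E := fun z =>
    BoundedContinuousFunction.ofNormedAddCommGroup (Ψ z) (hΨc z) _ (hbd z)
  have hΦ : ContractingWith (1 / 2) Φ := by
    refine ⟨by norm_num, LipschitzWith.of_dist_le_mul fun y z => ?_⟩
    refine (BoundedContinuousFunction.dist_le (by positivity)).2 fun t => ?_
    rw [dist_eq_norm]
    refine (hsub y z t).trans_eq ?_
    norm_num
    ring
  obtain ⟨z, hz⟩ : ∃ z, Φ z = z := ⟨_, hΦ.fixedPoint_isFixedPt⟩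
  refine ⟨fun t => p t • z t, hpc.smul z.continuous, fun t ht => ?_⟩
  have hzt : Ψ z t = z t := DFunLike.congr_fun hz t
  beta_reduce
  rw [← hzt]
  simp only [hΨ]
  rw [smul_smul, mul_inv_cancel₀ (hp0 t).ne', one_smul, max_eq_left ht]

end Existence

/-! ### Comparison functions -/

lemma isClassKInfty_id : IsClassKInfty fun r => r :=
  ⟨⟨continuousOn_id, strictMonoOn_id, rfl⟩, fun M =>
    ⟨|M| + 1, by positivity, (le_abs_self M).trans_lt (lt_add_one _)⟩⟩

lemma isClassKInfty_linear_add_sq {c d : ℝ} (hc : 0 < c) (hd : 0 ≤ d) :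
    IsClassKInfty fun r => c * r + d * r ^ 2 := by
  refine ⟨⟨by fun_prop, ?_, by simp⟩, fun M => ⟨(|M| + 1) / c, by positivity, ?_⟩⟩
  · intro x hx y hy hxy
    have h1 : x ^ 2 ≤ y ^ 2 := pow_le_pow_left₀ hx hxy.le 2
    have h2 := mul_lt_mul_of_pos_left hxy hc
    have h3 := mul_le_mul_of_nonneg_left h1 hd
    simp only
    linarith
  · have h1 : c * ((|M| + 1) / c) = |M| + 1 := by field_simp
    have h2 : 0 ≤ d * ((|M| + 1) / c) ^ 2 := by positivity
    have h3 := le_abs_self M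
    linarith

lemma isClassKL_exp {C c l : ℝ} (hC : 0 < C) (hc : 0 ≤ c) (hl : 0 < l) :
    IsClassKL fun r s => C * r * Real.exp (c * r) * Real.exp (-(l * s)) := by
  refine ⟨fun s _ => ⟨by fun_prop, ?_, by simp⟩, fun r hr => ⟨?_, ?_⟩⟩
  · intro x hx y hy hxy
    have hx' : 0 ≤ x := hx
    have hy' : 0 < y := hx'.trans_lt hxy
    have h1 : Real.exp (c * x) ≤ Real.exp (c * y) :=
      Real.exp_le_exp.2 (mul_le_mul_of_nonneg_left hxy.le hc)
    have h2 : C * x * Real.exp (c * x) < C * y * Real.exp (c * y) :=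
      mul_lt_mul (mul_lt_mul_of_pos_left hxy hC) h1 (Real.exp_pos _) (by positivity)
    exact mul_lt_mul_of_pos_right h2 (Real.exp_pos _)
  · intro s _ t _ hst
    have hr' : 0 ≤ r := hr
    have : Real.exp (-(l * t)) ≤ Real.exp (-(l * s)) :=
      Real.exp_le_exp.2 (neg_le_neg (mul_le_mul_of_nonneg_left hst hl.le))
    simp only
    gcongr
  · have h1 : Tendsto (fun s : ℝ => Real.exp (-(l * s))) atTop (𝓝 0) :=
      Real.tendsto_exp_neg_atTop_nhds_zero.comp (tendsto_id.const_mul_atTop hl)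
    simpa using h1.const_mul (C * r * Real.exp (c * r))


/-! ### Stability of abstract cascades -/

section Cascade

variable {E F : Type*} [NormedAddCommGroup E] [NormedSpace ℝ E] [CompleteSpace E]
  [NormedAddCommGroup F] [NormedSpace ℝ F] [CompleteSpace F]

lemma norm_le_of_linear_flow {L : F →L[ℝ] F} {k l : ℝ}
    (hL : ∀ t : ℝ, 0 ≤ t → ‖NormedSpace.exp (t • L)‖ ≤ k * Real.exp (-(l * t)))
    {y : ℝ → F} {a b : ℝ} (hyc : ContinuousOn y (Icc a b))
    (hy : ∀ t ∈ Icc a b, y t = y a + ∫ s in a..t, L (y s)) {t : ℝ} (ht : t ∈ Icc a b) :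
    ‖y t‖ ≤ k * ‖y a‖ * Real.exp (-(l * (t - a))) := by
  have h := eq_exp_add_integral (L := L) (q := fun _ => 0) (X := y) ht.1
    intervalIntegrable_const (hyc.mono (Icc_subset_Icc_right ht.2))
    (fun s hs => by simpa using hy s ⟨hs.1, hs.2.trans ht.2⟩)
  simp only [map_zero, intervalIntegral.integral_zero, add_zero] at h
  rw [h]
  refine (ContinuousLinearMap.le_opNorm _ _).trans ?_
  refine (mul_le_mul_of_nonneg_right (hL _ (sub_nonneg.2 ht.1)) (norm_nonneg _)).trans_eq ?_
  ring

/-- The driving system decays at twice the rate `l`. One half is spent on extracting the common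
factor `exp (-(l (t - a)))` from the convolution; the other leaves the decaying kernel that
`cascade_gronwall` needs. -/
lemma cascade_estimate {L₁ : E →L[ℝ] E} {L₂ : F →L[ℝ] F} {k l C M : ℝ} (hk : 0 < k) (hl : 0 < l)
    (hC : 0 ≤ C) (hM : 0 ≤ M)
    (hL₁ : ∀ t : ℝ, 0 ≤ t → ‖NormedSpace.exp (t • L₁)‖ ≤ k * Real.exp (-(l * t)))
    (hL₂ : ∀ t : ℝ, 0 ≤ t → ‖NormedSpace.exp (t • L₂)‖ ≤ k * Real.exp (-(2 * l * t)))
    {x q : ℝ → E} {y : ℝ → F} {ω : ℝ → ℝ} {a b : ℝ} (hab : a ≤ b)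
    (hq : IntervalIntegrable q volume a b) (hω : IntervalIntegrable ω volume a b)
    (hxc : ContinuousOn x (Icc a b)) (hyc : ContinuousOn y (Icc a b))
    (hx : ∀ t ∈ Icc a b, x t = x a + ∫ s in a..t, (L₁ (x s) + q s))
    (hy : ∀ t ∈ Icc a b, y t = y a + ∫ s in a..t, L₂ (y s))
    (hqle : ∀ s ∈ Icc a b, ‖q s‖ ≤ C * ‖y s‖ * (1 + ‖x s‖) + ω s)
    (hωM : ∀ t ∈ Icc a b, ∫ s in a..t, k * Real.exp (-(l * (t - s))) * ω s ≤ M) :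
    ‖x b‖ ≤ Real.exp (-(l * (b - a))) * Real.exp (k * C * k * ‖y a‖ / (2 * l)) *
      (k * ‖x a‖ + k * C * k * ‖y a‖ * (1 + M) / l) + M := by
  have key := cascade_gronwall (v := fun t => ‖x t‖) (ρ := k * C * k * ‖y a‖) (h₀ := k * ‖x a‖)
    (M := M) hab hl (by positivity) hM hxc.norm ?_
  · rwa [abs_of_nonneg (by positivity : 0 ≤ k * ‖x a‖)] at key
  intro t ht
  have hsub : uIcc a t ⊆ uIcc a b := by
    rw [uIcc_of_le hab, uIcc_of_le ht.1]
    exact Icc_subset_Icc_right ht.2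
  have hvar := eq_exp_add_integral (L := L₁) (q := q) (X := x) ht.1 (hq.mono_set hsub)
    (hxc.mono (Icc_subset_Icc_right ht.2)) (fun s hs => hx s ⟨hs.1, hs.2.trans ht.2⟩)
  set p : ℝ → ℝ := fun s => k * C * k * ‖y a‖ * Real.exp (-(l * (s - a))) * (1 + ‖x s‖) with hp
  have hpi : IntervalIntegrable p volume a t := by
    refine ContinuousOn.intervalIntegrable ?_
    rw [uIcc_of_le ht.1]
    have := (hxc.mono (Icc_subset_Icc_right ht.2)).norm
    fun_prop
  have hωi : IntervalIntegrable (fun s => k * Real.exp (-(l * (t - s))) * ω s) volume a t :=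
    (hω.mono_set hsub).continuousOn_mul (by fun_prop)
  have h1 : ∀ s ∈ Ioc a t, ‖NormedSpace.exp ((t - s) • L₁) (q s)‖ ≤
      Real.exp (-(l * (t - a))) * p s + k * Real.exp (-(l * (t - s))) * ω s := by
    intro s hs
    have hs' : s ∈ Icc a b := ⟨hs.1.le, hs.2.trans ht.2⟩
    have h2 := norm_le_of_linear_flow hL₂ hyc hy hs'
    have h3 : ‖q s‖ ≤ C * (k * ‖y a‖ * Real.exp (-(2 * l * (s - a)))) * (1 + ‖x s‖) + ω s := by
      refine (hqle s hs').trans ?_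
      gcongr
    have he : Real.exp (-(l * (t - s))) * Real.exp (-(2 * l * (s - a))) =
        Real.exp (-(l * (t - a))) * Real.exp (-(l * (s - a))) := by
      rw [← Real.exp_add, ← Real.exp_add]
      congr 1
      ring
    calc ‖NormedSpace.exp ((t - s) • L₁) (q s)‖
        ≤ k * Real.exp (-(l * (t - s))) *
          (C * (k * ‖y a‖ * Real.exp (-(2 * l * (s - a)))) * (1 + ‖x s‖) + ω s) :=
          (ContinuousLinearMap.le_opNorm _ _).trans
            (mul_le_mul (hL₁ _ (sub_nonneg.2 hs.2)) h3 (norm_nonneg _) (by positivity))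
      _ = k * C * k * ‖y a‖ * (1 + ‖x s‖) *
          (Real.exp (-(l * (t - s))) * Real.exp (-(2 * l * (s - a)))) +
          k * Real.exp (-(l * (t - s))) * ω s := by ring
      _ = _ := by rw [he, hp]; ring
  have h4 := intervalIntegral.norm_integral_le_of_norm_le ht.1 (ae_of_all _ h1)
    ((hpi.const_mul _).add hωi)
  rw [intervalIntegral.integral_add (hpi.const_mul _) hωi,
    intervalIntegral.integral_const_mul] at h4
  have h5 : ‖NormedSpace.exp ((t - a) • L₁) (x a)‖ ≤ k * Real.exp (-(l * (t - a))) * ‖x a‖ :=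
    (ContinuousLinearMap.le_opNorm _ _).trans
      (mul_le_mul_of_nonneg_right (hL₁ _ (sub_nonneg.2 ht.1)) (norm_nonneg _))
  have h6 : ‖x t‖ ≤ Real.exp (-(l * (t - a))) * (k * ‖x a‖ + ∫ s in a..t, p s) + M := by
    rw [hvar]
    refine (norm_add_le _ _).trans ?_
    have := hωM t ht
    linarith
  have hinv : Real.exp (l * (t - a)) * Real.exp (-(l * (t - a))) = 1 := by
    rw [← Real.exp_add, add_neg_cancel, Real.exp_zero]
  refine (mul_le_mul_of_nonneg_left h6 (Real.exp_pos _).le).trans_eq ?_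
  rw [mul_add, ← mul_assoc, hinv, one_mul]
  ring

/-- Young's inequality separates the contribution of the initial state from that of the input. -/
lemma separate_initial_state_and_input {e k c l R ρ M : ℝ} (he : 0 < e) (he1 : e ≤ 1) (hk : 0 < k)
    (hl : 0 < l) (hR : 0 ≤ R) (hM : 0 ≤ M) (hρ : 0 ≤ ρ) (hρc : ρ ≤ c * R) :
    e * Real.exp (ρ / (2 * l)) * (k * R + ρ * (1 + M) / l) + M + k * R * (e * e) ≤
      (2 * k + 2 * c / l) * R * Real.exp (3 * c / (2 * l) * R) * e + (M + M ^ 2 / 2) := by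
  set z := c * R / (2 * l) with hz
  have hz0 : 0 ≤ z := div_nonneg (hρ.trans hρc) (by positivity)
  set X := Real.exp z with hX
  have hX1 : 1 ≤ X := Real.one_le_exp hz0
  have hzX : z ≤ X := by linarith [Real.add_one_le_exp z]
  have hX3 : Real.exp (3 * c / (2 * l) * R) = X ^ 3 := by
    rw [hX, ← Real.exp_nat_mul]
    congr 1
    rw [hz]
    push_cast
    ring
  have hXρ : Real.exp (ρ / (2 * l)) ≤ X := Real.exp_le_exp.2 (by rw [hz]; gcongr)
  have hρz : ρ / l ≤ 2 * z := by
    have : 2 * z = c * R / l := by rw [hz]; field_simp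
    rw [this]
    gcongr
  have hρl : 0 ≤ ρ / l := by positivity
  have h1 : e * Real.exp (ρ / (2 * l)) * (k * R + ρ * (1 + M) / l) ≤
      e * X * (k * R + 2 * z * (1 + M)) := by
    have : ρ * (1 + M) / l = ρ / l * (1 + M) := by ring
    rw [this]
    gcongr
  -- One `k * R` for each subsystem; one `2 * z` for the part free of `M` and one for the square
  -- left by Young's inequality. Bounding a factor `z` by `X` in that square raises `X ^ 2` to `X ^
  -- 3`.
  have h2 : (2 * k + 2 * c / l) * R = 2 * (k * R) + 4 * z := by rw [hz]; field_simp; ring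
  rw [hX3, h2]
  have hkR : 0 ≤ k * R := by positivity
  have hX13 : X ≤ X ^ 3 := le_self_pow₀ hX1 (by norm_num)
  have hX03 : 1 ≤ X ^ 3 := one_le_pow₀ hX1
  have h3 : e * X * (2 * z) * M ≤ (e * X * (2 * z)) ^ 2 / 2 + M ^ 2 / 2 := by
    nlinarith [sq_nonneg (e * X * (2 * z) - M)]
  have h4 : (e * X * (2 * z)) ^ 2 / 2 ≤ e * (2 * z) * X ^ 3 := by
    have h5 : e * e ≤ e * 1 := mul_le_mul_of_nonneg_left he1 he.le
    calc (e * X * (2 * z)) ^ 2 / 2 = (e * e) * (2 * z) * X ^ 2 * z := by ring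
      _ ≤ (e * 1) * (2 * z) * X ^ 2 * X := by gcongr
      _ = _ := by ring
  have h6 : e * X * (k * R + 2 * z) ≤ e * X ^ 3 * (k * R + 2 * z) := by gcongr
  have h7 : k * R * (e * e) ≤ k * R * (e * X ^ 3) := by
    have : e ≤ X ^ 3 := he1.trans hX03
    gcongr
  linarith

end Cascade


/-! ### The tracking-error dynamics as a cascade -/

/-- The closed-loop matrix `A - B K` as an operator. -/
def loopOp (K : Matrix (Fin 3) (Fin 3 ⊕ Fin 3) ℝ) : E6 →L[ℝ] E6 :=
  Matrix.toEuclideanCLM (𝕜 := ℝ) (matA - matB * K)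

/-- The gain matrix as an operator. -/
def gainOp (K : Matrix (Fin 3) (Fin 3 ⊕ Fin 3) ℝ) : E6 →L[ℝ] E3 :=
  LinearMap.toContinuousLinearMap
    { toFun := mulCol K
      map_add' := fun x y => by ext i; simp [mulCol, Matrix.mulVec_add]
      map_smul' := fun c x => by ext i; simp [mulCol, Matrix.mulVec_smul] }

/-- The lower-block embedding `v ↦ [0; v]`. -/
def lowerOp : E3 →L[ℝ] E6 :=
  LinearMap.toContinuousLinearMap
    { toFun := stack 0
      map_add' := fun x y => by ext (i | i) <;> simp [stack]
      map_smul' := fun c x => by ext (i | i) <;> simp [stack] }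

lemma lowerOp_apply (v : E3) : lowerOp v = stack 0 v := rfl

lemma norm_lowerOp (v : E3) : ‖lowerOp v‖ = ‖v‖ := by
  rw [lowerOp_apply, EuclideanSpace.norm_eq, EuclideanSpace.norm_eq]
  simp [stack]

/-- The upper block as an operator. -/
def upperOp : E6 →L[ℝ] E3 :=
  LinearMap.toContinuousLinearMap
    { toFun := upper
      map_add' := fun x y => by ext i; simp [upper]
      map_smul' := fun c x => by ext i; simp [upper] }

lemma norm_upper_le (x : E6) : ‖upper x‖ ≤ ‖x‖ := by
  rw [EuclideanSpace.norm_eq, EuclideanSpace.norm_eq]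
  refine Real.sqrt_le_sqrt ?_
  rw [Fintype.sum_sum_type]
  exact le_add_of_nonneg_right (Finset.sum_nonneg fun _ _ => by positivity)

/-- The translational state as an operator. -/
def fstOp : State →L[ℝ] E6 :=
  LinearMap.toContinuousLinearMap
    { toFun := fstState
      map_add' := fun x y => by ext i; simp [fstState]
      map_smul' := fun c x => by ext i; simp [fstState] }

/-- The rotational state as an operator. -/
def sndOp : State →L[ℝ] E6 :=
  LinearMap.toContinuousLinearMap
    { toFun := sndState
      map_add' := fun x y => by ext i; simp [sndState]
      map_smul' := fun c x => by ext i; simp [sndState] }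

/-- The pairing of the two partial states as an operator. -/
def pairOp : E6 × E6 →L[ℝ] State :=
  LinearMap.toContinuousLinearMap
    { toFun := fun x => mkState x.1 x.2
      map_add' := fun x y => by ext (i | i) <;> simp [mkState]
      map_smul' := fun c x => by ext (i | i) <;> simp [mkState] }

lemma fstOp_apply (x : State) : fstOp x = fstState x := rfl
lemma sndOp_apply (x : State) : sndOp x = sndState x := rfl
lemma pairOp_apply (x : E6 × E6) : pairOp x = mkState x.1 x.2 := rfl

lemma fstState_mkState (x y : E6) : fstState (mkState x y) = x := rfl
lemma sndState_mkState (x y : E6) : sndState (mkState x y) = y := rfl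
lemma mkState_fstState_sndState (x : State) : mkState (fstState x) (sndState x) = x := by
  ext (i | i) <;> rfl

lemma norm_sq_state (x : State) : ‖x‖ ^ 2 = ‖fstState x‖ ^ 2 + ‖sndState x‖ ^ 2 := by
  rw [EuclideanSpace.norm_sq_eq, EuclideanSpace.norm_sq_eq, EuclideanSpace.norm_sq_eq,
    Fintype.sum_sum_type]
  rfl

lemma norm_fstState_le (x : State) : ‖fstState x‖ ≤ ‖x‖ := by
  refine le_of_sq_le_sq ?_ (norm_nonneg _)
  rw [norm_sq_state x]
  exact le_add_of_nonneg_right (by positivity)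

lemma norm_sndState_le (x : State) : ‖sndState x‖ ≤ ‖x‖ := by
  refine le_of_sq_le_sq ?_ (norm_nonneg _)
  rw [norm_sq_state x]
  exact le_add_of_nonneg_left (by positivity)

lemma norm_state_le (x : State) : ‖x‖ ≤ ‖fstState x‖ + ‖sndState x‖ := by
  refine le_of_sq_le_sq ?_ (by positivity)
  rw [norm_sq_state x]
  nlinarith [norm_nonneg (fstState x), norm_nonneg (sndState x)]

/-- The coupling term of the translational dynamics. -/
def coupling (grav : ℝ) (K : Matrix (Fin 3) (Fin 3 ⊕ Fin 3) ℝ) (acc τ θ : E3) (x : E6) : E6 :=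
  lowerOp (‖-gainOp K x + acc - grav • basisVec 2‖ • thrustError θ τ)

/-- The feedforward terms cancel and the mass divides out of `f / m`. Thus `angAcc` disappears and
needs no regularity, while the desired acceleration survives in the thrust magnitude. -/
lemma closedLoop_eq {m grav : ℝ} (hm : 0 < m) (τ ξd : ℝ → E3) (angAcc : ℝ → State → E3 → E3)
    (K₁ K₂ : Matrix (Fin 3) (Fin 3 ⊕ Fin 3) ℝ) (t : ℝ) (x : State) (w : E3) :
    closedLoop m grav τ ξd angAcc K₁ K₂ t x w =
      mkState (loopOp K₁ (fstState x) +
        (coupling grav K₁ (desiredAcc ξd t) (τ t) (upper (sndState x)) (fstState x) + lowerOp w))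
        (loopOp K₂ (sndState x)) := by
  have hloop : ∀ (K : Matrix (Fin 3) (Fin 3 ⊕ Fin 3) ℝ) (y : E6) (c : E3),
      mulCol matA y + mulCol matB (-mulCol K y + c - c) = loopOp K y := by
    intro K y c
    rw [add_sub_cancel_right]
    ext i
    simp [mulCol, loopOp, Matrix.mulVec_neg, sub_eq_add_neg,
      ← Matrix.mulVec_mulVec]
  rw [closedLoop, trackingField, hloop, hloop, interconnection, thrust,
    mul_div_cancel_left₀ _ hm.ne', add_assoc]
  rfl


lemma exists_norm_coupling_le (grav : ℝ) (K : Matrix (Fin 3) (Fin 3 ⊕ Fin 3) ℝ) (A : ℝ) :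
    ∃ C : ℝ, 0 ≤ C ∧ ∀ (acc τ : E3) (x y : E6), ‖acc‖ ≤ A → ‖τ‖ = 1 →
      ‖coupling grav K acc τ (upper y) x‖ ≤ C * ‖y‖ * (1 + ‖x‖) := by
  obtain ⟨C, hC, hte⟩ := exists_norm_thrustError_le
  refine ⟨(‖gainOp K‖ + |A| + |grav|) * C, by positivity, fun acc τ x y hacc hτ => ?_⟩
  have h1 : ‖thrustError (upper y) τ‖ ≤ C * ‖y‖ := by
    refine (hte _ _).trans ?_
    rw [hτ, mul_one]
    exact mul_le_mul_of_nonneg_left (norm_upper_le y) hC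
  have h2 : ‖-gainOp K x + acc - grav • basisVec 2‖ ≤
      (‖gainOp K‖ + |A| + |grav|) * (1 + ‖x‖) := by
    have h3 : ‖-gainOp K x + acc - grav • basisVec 2‖ ≤ ‖gainOp K x‖ + ‖acc‖ + |grav| := by
      refine (norm_sub_le _ _).trans (add_le_add ((norm_add_le _ _).trans ?_) ?_)
      · rw [norm_neg]
      · simp [norm_smul, basisVec]
    have h4 := (gainOp K).le_opNorm x
    have h5 := hacc.trans (le_abs_self A)
    have h6 : 0 ≤ (|A| + |grav|) * ‖x‖ := by positivity
    nlinarith [norm_nonneg (gainOp K)]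
  rw [coupling, norm_lowerOp, norm_smul, norm_norm]
  calc _ ≤ (‖gainOp K‖ + |A| + |grav|) * (1 + ‖x‖) * (C * ‖y‖) := by gcongr
    _ = _ := by ring

lemma IsInput.integrableOn_Icc {w : ℝ → E3} (hw : IsInput w) (T : ℝ) :
    IntegrableOn w (Icc 0 T) := by
  obtain ⟨C, hC⟩ := hw.2 T
  refine Integrable.of_bound ?_ C hC
  exact hw.1.mono_measure (Measure.restrict_mono Icc_subset_Ici_self le_rfl)

lemma IsInput.intervalIntegrable {w : ℝ → E3} (hw : IsInput w) {a b : ℝ} (ha : 0 ≤ a)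
    (hab : a ≤ b) : IntervalIntegrable w volume a b := by
  rw [intervalIntegrable_iff_integrableOn_Ioc_of_le hab]
  exact (hw.integrableOn_Icc b).mono_set fun s hs => ⟨ha.trans hs.1.le, hs.2⟩

/-! ### Decay estimate and robustness of the closed loop -/

section ClosedLoop

variable {m grav : ℝ} {τ ξd : ℝ → E3} {angAcc : ℝ → State → E3 → E3}
  {K₁ K₂ : Matrix (Fin 3) (Fin 3 ⊕ Fin 3) ℝ}

/-- Every solution is bounded by a decaying term depending on the initial state and a term depending
on a bound of the exponentially filtered perturbation. -/
lemma exists_closedLoop_estimate (hm : 0 < m) (hτ1 : ∀ t : ℝ, 0 ≤ t → ‖τ t‖ = 1)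
    (hacc : ∃ C : ℝ, ∀ t : ℝ, 0 ≤ t → ‖desiredAcc ξd t‖ ≤ C)
    (hK₁ : IsHurwitz (matA - matB * K₁)) (hK₂ : IsHurwitz (matA - matB * K₂)) :
    ∃ (k l : ℝ) (β : ℝ → ℝ → ℝ), 0 < k ∧ 0 < l ∧ IsClassKL β ∧
      ∀ (w : ℝ → E3) (x : ℝ → State) (a b M : ℝ), IsInput w → 0 ≤ a → a ≤ b → 0 ≤ M →
        IsSolutionOn (closedLoop m grav τ ξd angAcc K₁ K₂) w x a b →
        (∀ t ∈ Icc a b, ∫ s in a..t, k * Real.exp (-(l * (t - s))) * ‖w s‖ ≤ M) →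
        ‖x b‖ ≤ β ‖x a‖ (b - a) + (M + M ^ 2 / 2) := by
  obtain ⟨k₁, l₁, hk₁, hl₁, hL₁⟩ := hK₁.exists_norm_exp_le
  obtain ⟨k₂, l₂, hk₂, hl₂, hL₂⟩ := hK₂.exists_norm_exp_le
  obtain ⟨A, hA⟩ := hacc
  obtain ⟨C, hC, hcoup⟩ := exists_norm_coupling_le grav K₁ A
  set k := max k₁ k₂
  -- Halving the slower rate gives the angular subsystem the decay rate `2 * l`.
  set l := min l₁ l₂ / 2 with hl_def
  have hk : 0 < k := hk₁.trans_le (le_max_left _ _)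
  have hl : 0 < l := half_pos (lt_min hl₁ hl₂)
  have h2l : 2 * l = min l₁ l₂ := by rw [hl_def]; ring
  have hL₁' : ∀ t : ℝ, 0 ≤ t → ‖NormedSpace.exp (t • loopOp K₁)‖ ≤ k * Real.exp (-(l * t)) := by
    intro t ht
    refine (hL₁ t ht).trans (mul_le_mul (le_max_left _ _) (Real.exp_le_exp.2 (neg_le_neg ?_))
      (Real.exp_pos _).le hk.le)
    exact mul_le_mul_of_nonneg_right (by linarith [min_le_left l₁ l₂]) ht
  have hL₂' : ∀ t : ℝ, 0 ≤ t →
      ‖NormedSpace.exp (t • loopOp K₂)‖ ≤ k * Real.exp (-(2 * l * t)) := by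
    intro t ht
    refine (hL₂ t ht).trans (mul_le_mul (le_max_right _ _) (Real.exp_le_exp.2 (neg_le_neg ?_))
      (Real.exp_pos _).le hk.le)
    exact mul_le_mul_of_nonneg_right (by linarith [min_le_right l₁ l₂]) ht
  refine ⟨k, l, _, hk, hl, isClassKL_exp (C := 2 * k + 2 * (k * C * k) / l)
    (c := 3 * (k * C * k) / (2 * l)) (by positivity) (by positivity) hl, ?_⟩
  intro w x a b M hw ha hab hM hx hωM
  obtain ⟨hFi, hxeq⟩ := hx
  have hxc : ContinuousOn x (Icc a b) := continuousOn_of_eq_integral hab hFi hxeq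
  set F : ℝ → State := fun s => closedLoop m grav τ ξd angAcc K₁ K₂ s (x s) (w s) with hF
  have hcomp : ∀ (P : State →L[ℝ] E6), ∀ t ∈ Icc a b, P (x t) = P (x a) + ∫ s in a..t, P (F s) := by
    intro P t ht
    have hsub : uIcc a t ⊆ uIcc a b := by
      rw [uIcc_of_le hab, uIcc_of_le ht.1]
      exact Icc_subset_Icc_right ht.2
    rw [P.intervalIntegral_comp_comm (hFi.mono_set hsub), ← map_add, ← hxeq t ht]
  have hPF : ∀ P : State →L[ℝ] E6, IntervalIntegrable (fun s => P (F s)) volume a b := fun P =>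
    intervalIntegrable_clm_apply continuous_const hFi
  set x₁ : ℝ → E6 := fun s => fstState (x s) with hx₁
  set x₂ : ℝ → E6 := fun s => sndState (x s) with hx₂
  have hx₁c : ContinuousOn x₁ (Icc a b) := fstOp.continuous.comp_continuousOn hxc
  have hx₂c : ContinuousOn x₂ (Icc a b) := sndOp.continuous.comp_continuousOn hxc
  set q : ℝ → E6 := fun s =>
    coupling grav K₁ (desiredAcc ξd s) (τ s) (upper (x₂ s)) (x₁ s) + lowerOp (w s) with hq
  have hF1 : ∀ s, fstOp (F s) = loopOp K₁ (x₁ s) + q s := fun s => by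
    simp only [hF]
    rw [closedLoop_eq hm, fstOp_apply, fstState_mkState]
  have hF2 : ∀ s, sndOp (F s) = loopOp K₂ (x₂ s) := fun s => by
    simp only [hF]
    rw [closedLoop_eq hm, sndOp_apply, sndState_mkState]
  have hx₁eq : ∀ t ∈ Icc a b, x₁ t = x₁ a + ∫ s in a..t, (loopOp K₁ (x₁ s) + q s) := by
    intro t ht
    simp only [← hF1]
    exact hcomp fstOp t ht
  have hx₂eq : ∀ t ∈ Icc a b, x₂ t = x₂ a + ∫ s in a..t, loopOp K₂ (x₂ s) := by
    intro t ht
    simp only [← hF2]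
    exact hcomp sndOp t ht
  -- Integrability is read off from the solution itself, as right-hand side minus linear part;
  -- measurability of `τ` and of the acceleration is not at hand.
  have hqi : IntervalIntegrable q volume a b := by
    have h1 : IntervalIntegrable (fun s => loopOp K₁ (x₁ s)) volume a b := by
      refine ContinuousOn.intervalIntegrable ?_
      rw [uIcc_of_le hab]
      exact (loopOp K₁).continuous.comp_continuousOn hx₁c
    refine ((hPF fstOp).sub h1).congr fun s _ => ?_
    rw [hF1 s]
    simp
  have hwi : IntervalIntegrable (fun s => ‖w s‖) volume a b := (hw.intervalIntegrable ha hab).norm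
  have hqle : ∀ s ∈ Icc a b, ‖q s‖ ≤ C * ‖x₂ s‖ * (1 + ‖x₁ s‖) + ‖w s‖ := by
    intro s hs
    have hs0 := ha.trans hs.1
    refine (norm_add_le _ _).trans (add_le_add ?_ (norm_lowerOp _).le)
    exact hcoup _ _ _ _ (hA s hs0) (hτ1 s hs0)
  have hest := cascade_estimate hk hl hC hM hL₁' hL₂' hab hqi hwi hx₁c hx₂c hx₁eq hx₂eq hqle hωM
  have hest₂ := norm_le_of_linear_flow hL₂' hx₂c hx₂eq (right_mem_Icc.2 hab)
  have he1 : Real.exp (-(l * (b - a))) ≤ 1 :=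
    Real.exp_le_one_iff.2 (neg_nonpos.2 (mul_nonneg hl.le (sub_nonneg.2 hab)))
  have hρc : k * C * k * ‖x₂ a‖ ≤ k * C * k * ‖x a‖ :=
    mul_le_mul_of_nonneg_left (norm_sndState_le _) (by positivity)
  have hsep := separate_initial_state_and_input (e := Real.exp (-(l * (b - a))))
    (k := k) (c := k * C * k) (l := l) (R := ‖x a‖) (ρ := k * C * k * ‖x₂ a‖) (M := M)
    (Real.exp_pos _) he1 hk hl (norm_nonneg _) hM (by positivity) hρc
  have hee : Real.exp (-(2 * l * (b - a))) =
      Real.exp (-(l * (b - a))) * Real.exp (-(l * (b - a))) := by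
    rw [← Real.exp_add]
    congr 1
    ring
  have h₁ : ‖x₁ b‖ ≤ Real.exp (-(l * (b - a))) * Real.exp (k * C * k * ‖x₂ a‖ / (2 * l)) *
      (k * ‖x a‖ + k * C * k * ‖x₂ a‖ * (1 + M) / l) + M := by
    refine hest.trans ?_
    have : ‖x₁ a‖ ≤ ‖x a‖ := norm_fstState_le _
    gcongr
  have h₂ : ‖x₂ b‖ ≤ k * ‖x a‖ * (Real.exp (-(l * (b - a))) * Real.exp (-(l * (b - a)))) := by
    rw [hee] at hest₂
    refine hest₂.trans ?_
    have : ‖x₂ a‖ ≤ ‖x a‖ := norm_sndState_le _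
    gcongr
  calc ‖x b‖ ≤ ‖x₁ b‖ + ‖x₂ b‖ := norm_state_le _
    _ ≤ _ := add_le_add h₁ h₂
    _ ≤ _ := hsep

/-- The filter kernel is at most `k`, so `M = k ∫ ‖w‖` is admissible. -/
lemma closedLoop_isIISS (hm : 0 < m) (hτ1 : ∀ t : ℝ, 0 ≤ t → ‖τ t‖ = 1)
    (hacc : ∃ C : ℝ, ∀ t : ℝ, 0 ≤ t → ‖desiredAcc ξd t‖ ≤ C)
    (hK₁ : IsHurwitz (matA - matB * K₁)) (hK₂ : IsHurwitz (matA - matB * K₂)) :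
    IsIISS (closedLoop m grav τ ξd angAcc K₁ K₂) := by
  obtain ⟨k, l, β, hk, hl, hβ, hest⟩ :=
    exists_closedLoop_estimate (grav := grav) (angAcc := angAcc) hm hτ1 hacc hK₁ hK₂
  refine ⟨β, fun r => k * r + k ^ 2 / 2 * r ^ 2, fun r => r, hβ,
    isClassKInfty_linear_add_sq hk (by positivity), isClassKInfty_id, ?_⟩
  intro w x a b hw ha hab hx
  have hwi : IntervalIntegrable (fun s => ‖w s‖) volume a b := (hw.intervalIntegrable ha hab).norm
  have hW0 : 0 ≤ ∫ s in a..b, ‖w s‖ := intervalIntegral.integral_nonneg hab fun _ _ => norm_nonneg _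
  refine (hest w x a b (k * ∫ s in a..b, ‖w s‖) hw ha hab (by positivity) hx ?_).trans_eq ?_
  · intro t ht
    have hsub : uIcc a t ⊆ uIcc a b := by
      rw [uIcc_of_le hab, uIcc_of_le ht.1]
      exact Icc_subset_Icc_right ht.2
    have h1 : ∫ s in a..t, k * Real.exp (-(l * (t - s))) * ‖w s‖ ≤ ∫ s in a..t, k * ‖w s‖ := by
      refine intervalIntegral.integral_mono_on ht.1
        ((hwi.mono_set hsub).continuousOn_mul (by fun_prop)) ((hwi.mono_set hsub).const_mul k) ?_
      intro s hs
      have : Real.exp (-(l * (t - s))) ≤ 1 :=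
        Real.exp_le_one_iff.2 (neg_nonpos.2 (mul_nonneg hl.le (sub_nonneg.2 hs.2)))
      exact mul_le_mul_of_nonneg_right (mul_le_of_le_one_right hk.le this) (norm_nonneg _)
    refine h1.trans ?_
    rw [intervalIntegral.integral_const_mul]
    exact mul_le_mul_of_nonneg_left (intervalIntegral.integral_mono_interval le_rfl ht.1 ht.2
      (ae_of_all _ fun _ => norm_nonneg _) hwi) hk.le
  · ring

/-- The filter kernel has total mass at most `k / l`, so `M = (k / l) sup ‖w‖` is admissible. -/
lemma closedLoop_isISSSmallInputs (hm : 0 < m) (hτ1 : ∀ t : ℝ, 0 ≤ t → ‖τ t‖ = 1)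
    (hacc : ∃ C : ℝ, ∀ t : ℝ, 0 ≤ t → ‖desiredAcc ξd t‖ ≤ C)
    (hK₁ : IsHurwitz (matA - matB * K₁)) (hK₂ : IsHurwitz (matA - matB * K₂)) :
    IsISSSmallInputs (closedLoop m grav τ ξd angAcc K₁ K₂) := by
  obtain ⟨k, l, β, hk, hl, hβ, hest⟩ :=
    exists_closedLoop_estimate (grav := grav) (angAcc := angAcc) hm hτ1 hacc hK₁ hK₂
  -- The radius `1` is arbitrary. It only ensures that the norms are bounded above, since `sSup` of
  -- an unbounded set of reals is `0`.
  refine ⟨1, β, fun r => k / l * r + (k / l) ^ 2 / 2 * r ^ 2, one_pos, hβ,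
    isClassKInfty_linear_add_sq (by positivity) (by positivity), ?_⟩
  intro w x a b hw ha hab hx hsmall
  set S := sSup ((fun s => ‖w s‖) '' Icc a b) with hS
  have hwS : ∀ s ∈ Icc a b, ‖w s‖ ≤ S := fun s hs =>
    le_csSup ⟨1, by rintro _ ⟨s, hs, rfl⟩; exact (hsmall s hs).le⟩ (mem_image_of_mem _ hs)
  have hS0 : 0 ≤ S := (norm_nonneg _).trans (hwS a (left_mem_Icc.2 hab))
  have hwi : IntervalIntegrable (fun s => ‖w s‖) volume a b := (hw.intervalIntegrable ha hab).norm
  refine (hest w x a b (k / l * S) hw ha hab (by positivity) hx ?_).trans_eq ?_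
  · intro t ht
    have hsub : uIcc a t ⊆ uIcc a b := by
      rw [uIcc_of_le hab, uIcc_of_le ht.1]
      exact Icc_subset_Icc_right ht.2
    have hd : ∀ s, HasDerivAt (fun s => k / l * S * Real.exp (-(l * (t - s))))
        (k * Real.exp (-(l * (t - s))) * S) s := by
      intro s
      have h1 : HasDerivAt (fun s => -(l * (t - s))) (-(l * (-1))) s :=
        (((hasDerivAt_id s).const_sub t).const_mul l).neg
      convert! h1.exp.const_mul (k / l * S) using 1
      field_simp
    have hc : Continuous fun s => k * Real.exp (-(l * (t - s))) * S := by fun_prop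
    calc ∫ s in a..t, k * Real.exp (-(l * (t - s))) * ‖w s‖
        ≤ ∫ s in a..t, k * Real.exp (-(l * (t - s))) * S := by
          refine intervalIntegral.integral_mono_on ht.1
            ((hwi.mono_set hsub).continuousOn_mul (by fun_prop)) (hc.intervalIntegrable _ _) ?_
          intro s hs
          have := hwS s ⟨hs.1, hs.2.trans ht.2⟩
          gcongr
      _ = k / l * S * Real.exp (-(l * (t - t))) - k / l * S * Real.exp (-(l * (t - a))) :=
          intervalIntegral.integral_eq_sub_of_hasDerivAt (fun s _ => hd s)
            (hc.intervalIntegrable _ _)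
      _ ≤ k / l * S := by
          have : 0 ≤ k / l * S * Real.exp (-(l * (t - a))) := by positivity
          simp only [sub_self, mul_zero, neg_zero, Real.exp_zero, mul_one]
          linarith
  · ring

end ClosedLoop

lemma isInput_zero : IsInput fun _ : ℝ => (0 : E3) :=
  ⟨aestronglyMeasurable_const, fun _ => ⟨0, ae_of_all _ fun _ => by simp⟩⟩

lemma IsIISS.isZeroUGAS {F : ℝ → State → E3 → State} (h : IsIISS F) : IsZeroUGAS F := by
  obtain ⟨β, μ₁, μ₂, hβ, hμ₁, hμ₂, hF⟩ := h
  refine ⟨β, hβ, fun x a b ha hab hx => ?_⟩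
  have := hF _ x a b isInput_zero ha hab hx
  simpa [hμ₁.1.2.2, hμ₂.1.2.2] using this

/-! ### Forward completeness -/

section GlobalSolutions

variable {E : Type*} [NormedAddCommGroup E] [NormedSpace ℝ E] [CompleteSpace E]

lemma hasDerivAt_exp_flow (L : E →L[ℝ] E) (a s : ℝ) (y₀ : E) :
    HasDerivAt (fun s : ℝ => NormedSpace.exp ((s - a) • L) y₀)
      (L (NormedSpace.exp ((s - a) • L) y₀)) s := by
  have h1 := (hasDerivAt_exp_smul_const' (𝕂 := ℝ) L (s - a)).comp_sub_const s a
  simpa using h1.clm_apply (hasDerivAt_const s y₀)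

lemma continuous_exp_flow (L : E →L[ℝ] E) (a : ℝ) (y₀ : E) :
    Continuous fun s : ℝ => NormedSpace.exp ((s - a) • L) y₀ :=
  continuous_iff_continuousAt.2 fun s => (hasDerivAt_exp_flow L a s y₀).continuousAt

lemma exists_linear_flow (L : E →L[ℝ] E) (a : ℝ) (y₀ : E) :
    ∃ y : ℝ → E, Continuous y ∧ y a = y₀ ∧ ∀ t, y t = y a + ∫ s in a..t, L (y s) := by
  refine ⟨fun t => NormedSpace.exp ((t - a) • L) y₀, continuous_exp_flow L a y₀, by simp,
    fun t => ?_⟩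
  rw [intervalIntegral.integral_eq_sub_of_hasDerivAt (fun s _ => hasDerivAt_exp_flow L a s y₀)
    ((L.continuous.comp (continuous_exp_flow L a y₀)).intervalIntegrable _ _)]
  abel

/-- A continuous field that is globally Lipschitz in the state has global forward Carathéodory
solutions under additive integrable inputs. -/
lemma exists_global_solution_add_input {g : ℝ → E → E} (hg : Continuous (Function.uncurry g))
    {K : ℝ} (hK : 0 ≤ K) (hLip : ∀ t x y, ‖g t x - g t y‖ ≤ K * ‖x - y‖) {v : ℝ → E}
    (hv : ∀ b d, IntervalIntegrable v volume b d) (a : ℝ) (x₀ : E) :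
    ∃ x : ℝ → E, Continuous x ∧ ∀ t, a ≤ t → x t = x₀ + ∫ s in a..t, (g s (x s) + v s) := by
  -- Subtracting the primitive of the input leaves a continuous field with the same Lipschitz
  -- constant.
  set W : ℝ → E := fun t => ∫ s in a..t, v s
  have hWc : Continuous W := intervalIntegral.continuous_primitive hv a
  have hgc : Continuous (Function.uncurry fun t y => g t (y + W t)) :=
    hg.comp (continuous_fst.prodMk (continuous_snd.add (hWc.comp continuous_fst)))
  obtain ⟨y, hyc, hy⟩ := exists_global_solution hgc hK
    (fun t x y => by simpa using hLip t (x + W t) (y + W t)) a x₀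
  refine ⟨fun t => y t + W t, hyc.add hWc, fun t ht => ?_⟩
  have hc : Continuous fun s => g s (y s + W s) := hgc.comp (continuous_id.prodMk hyc)
  rw [intervalIntegral.integral_add (hc.intervalIntegrable _ _) (hv a t), ← add_assoc, ← hy t ht]

end GlobalSolutions

/-- The state `x` enters only through the norm of an affine map, which the reverse triangle
inequality makes Lipschitz. -/
lemma norm_coupling_sub_le (grav : ℝ) (K : Matrix (Fin 3) (Fin 3 ⊕ Fin 3) ℝ) (acc τ θ : E3)
    (x y : E6) : ‖coupling grav K acc τ θ x - coupling grav K acc τ θ y‖ ≤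
      ‖gainOp K‖ * ‖thrustError θ τ‖ * ‖x - y‖ := by
  rw [coupling, coupling, ← map_sub, norm_lowerOp, ← sub_smul, norm_smul, Real.norm_eq_abs]
  have h1 := abs_norm_sub_norm_le (-gainOp K x + acc - grav • basisVec 2)
    (-gainOp K y + acc - grav • basisVec 2)
  have h2 : -gainOp K x + acc - grav • basisVec 2 - (-gainOp K y + acc - grav • basisVec 2) =
      -(gainOp K (x - y)) := by
    rw [map_sub]
    abel
  rw [h2, norm_neg] at h1
  calc _ ≤ ‖gainOp K‖ * ‖x - y‖ * ‖thrustError θ τ‖ :=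
        mul_le_mul_of_nonneg_right (h1.trans ((gainOp K).le_opNorm _)) (norm_nonneg _)
    _ = _ := by ring

lemma Continuous.coupling {X : Type*} [TopologicalSpace X] {grav : ℝ}
    {K : Matrix (Fin 3) (Fin 3 ⊕ Fin 3) ℝ} {acc τ θ : X → E3} {x : X → E6} (hacc : Continuous acc)
    (hτ : Continuous τ) (hθ : Continuous θ) (hx : Continuous x) :
    Continuous fun p => coupling grav K (acc p) (τ p) (θ p) (x p) := by
  have h1 : Continuous fun p => thrustError (θ p) (τ p) :=
    (continuous_thrustError.comp (hθ.prodMk hτ) :)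
  have h2 : Continuous fun p => gainOp K (x p) := (gainOp K).continuous.comp hx
  have h3 : Continuous fun p => ‖-gainOp K (x p) + acc p - grav • basisVec 2‖ :=
    ((h2.neg.add hacc).sub continuous_const).norm
  exact lowerOp.continuous.comp (h3.smul h1)


/-- Joining forward solutions of the two subsystems yields a solution of the closed loop. -/
lemma isSolutionOn_mkState {m grav : ℝ} (hm : 0 < m) {τ ξd : ℝ → E3}
    {angAcc : ℝ → State → E3 → E3} {K₁ K₂ : Matrix (Fin 3) (Fin 3 ⊕ Fin 3) ℝ} {w : ℝ → E3}
    {x₁ x₂ g₁ : ℝ → E6} {a t : ℝ} (hat : a ≤ t)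
    (hg₁ : ∀ s ∈ Icc a t, g₁ s = loopOp K₁ (x₁ s) +
      (coupling grav K₁ (desiredAcc ξd s) (τ s) (upper (x₂ s)) (x₁ s) + lowerOp (w s)))
    (hg₁i : IntervalIntegrable g₁ volume a t) (hx₂c : Continuous x₂)
    (hx₁ : ∀ r ∈ Icc a t, x₁ r = x₁ a + ∫ s in a..r, g₁ s)
    (hx₂ : ∀ r ∈ Icc a t, x₂ r = x₂ a + ∫ s in a..r, loopOp K₂ (x₂ s)) :
    IsSolutionOn (closedLoop m grav τ ξd angAcc K₁ K₂) w (fun s => mkState (x₁ s) (x₂ s)) a t := by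
  have hL₂i : ∀ b d, IntervalIntegrable (fun s => loopOp K₂ (x₂ s)) volume b d := fun b d =>
    ((loopOp K₂).continuous.comp hx₂c).intervalIntegrable b d
  have hF : ∀ s ∈ Icc a t, pairOp (g₁ s, loopOp K₂ (x₂ s)) =
      closedLoop m grav τ ξd angAcc K₁ K₂ s (mkState (x₁ s) (x₂ s)) (w s) := by
    intro s hs
    rw [closedLoop_eq hm, pairOp_apply, fstState_mkState, sndState_mkState, hg₁ s hs]
  have hGi : IntervalIntegrable (fun s => (g₁ s, loopOp K₂ (x₂ s))) volume a t :=
    ⟨hg₁i.1.prodMk (hL₂i a t).1, hg₁i.2.prodMk (hL₂i a t).2⟩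
  refine ⟨?_, fun r hr => ?_⟩
  · refine (intervalIntegrable_clm_apply (Φ := fun _ => pairOp) continuous_const
      hGi).congr fun s hs => ?_
    rw [uIoc_of_le hat] at hs
    exact hF s (Ioc_subset_Icc_self hs)
  · have hsub : uIcc a r ⊆ uIcc a t := by
      rw [uIcc_of_le hat, uIcc_of_le hr.1]
      exact Icc_subset_Icc_right hr.2
    have h1 : ∫ s in a..r, closedLoop m grav τ ξd angAcc K₁ K₂ s (mkState (x₁ s) (x₂ s)) (w s) =
        ∫ s in a..r, pairOp (g₁ s, loopOp K₂ (x₂ s)) := by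
      refine intervalIntegral.integral_congr fun s hs => ?_
      rw [uIcc_of_le hr.1] at hs
      exact (hF s ⟨hs.1, hs.2.trans hr.2⟩).symm
    have h2 : ∫ s in a..r, (g₁ s, loopOp K₂ (x₂ s)) =
        (∫ s in a..r, g₁ s, ∫ s in a..r, loopOp K₂ (x₂ s)) := by
      simp only [intervalIntegral.integral_of_le hr.1]
      exact integral_pair (hg₁i.mono_set hsub).1 (hL₂i a r).1
    have h3 : ∀ s, mkState (x₁ s) (x₂ s) = pairOp (x₁ s, x₂ s) := fun s => rfl
    rw [h1, pairOp.intervalIntegral_comp_comm (hGi.mono_set hsub), h2]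
    beta_reduce
    rw [h3, h3, ← map_add, Prod.mk_add_mk, ← hx₁ r hr, ← hx₂ r hr]

/-- Hurwitz decay keeps the angular flow bounded, hence the thrust-direction error too. This gives
the translational field a Lipschitz constant uniform in time. -/
lemma closedLoop_forwardComplete {m grav : ℝ} (hm : 0 < m) {τ ξd : ℝ → E3}
    (hτ : ContinuousOn τ (Ici 0)) (hτ1 : ∀ t : ℝ, 0 ≤ t → ‖τ t‖ = 1)
    (hξd : ContDiffOn ℝ 2 ξd (Ici 0)) {angAcc : ℝ → State → E3 → E3}
    {K₁ K₂ : Matrix (Fin 3) (Fin 3 ⊕ Fin 3) ℝ} (hK₂ : IsHurwitz (matA - matB * K₂)) :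
    ForwardComplete (closedLoop m grav τ ξd angAcc K₁ K₂) := by
  intro w hw a ha x₀
  obtain ⟨k, l, hk, hl, hL₂⟩ := hK₂.exists_norm_exp_le
  obtain ⟨C, hC, hte⟩ := exists_norm_thrustError_le
  obtain ⟨x₂, hx₂c, hx₂a, hx₂⟩ := exists_linear_flow (loopOp K₂) a (sndState x₀)
  have hx₂le : ∀ t, a ≤ t → ‖x₂ t‖ ≤ k * ‖sndState x₀‖ := by
    intro t ht
    refine (norm_le_of_linear_flow hL₂ hx₂c.continuousOn (fun s _ => hx₂ s)
      (right_mem_Icc.2 ht)).trans ?_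
    rw [hx₂a]
    exact mul_le_of_le_one_right (by positivity)
      (Real.exp_le_one_iff.2 (neg_nonpos.2 (mul_nonneg hl.le (sub_nonneg.2 ht))))
  have hcc : Continuous fun t : ℝ => max t a := by fun_prop
  have hc0 : ∀ t, max t a ∈ Ici (0 : ℝ) := fun t => ha.trans (le_max_right _ _)
  have hτc : Continuous fun t => τ (max t a) := hτ.comp_continuous hcc hc0
  have hac : Continuous fun t => desiredAcc ξd (max t a) :=
    (hξd.continuousOn_iteratedDerivWithin le_rfl (uniqueDiffOn_Ici 0)).comp_continuous hcc hc0
  have hθc : Continuous fun t => upper (x₂ (max t a)) :=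
    upperOp.continuous.comp (hx₂c.comp hcc)
  obtain ⟨v, hvw, hvi⟩ : ∃ v : ℝ → E6, (∀ s, 0 ≤ s → v s = lowerOp (w s)) ∧
      ∀ b d, IntervalIntegrable v volume b d := by
    -- Nothing is known about `w` at negative times, so it is extended by zero.
    refine ⟨(Ici 0).indicator fun s => lowerOp (w s), fun s hs => indicator_of_mem hs _,
      fun b d => ?_⟩
    rw [intervalIntegrable_iff, integrableOn_indicator_iff measurableSet_Ici]
    refine (lowerOp.integrable_comp (hw.integrableOn_Icc (max b d))).mono_measure
      (Measure.restrict_mono ?_ le_rfl)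
    exact fun s hs => ⟨hs.1, hs.2.2⟩
  have hgc : Continuous (Function.uncurry fun t y => loopOp K₁ y +
      coupling grav K₁ (desiredAcc ξd (max t a)) (τ (max t a)) (upper (x₂ (max t a))) y) :=
    ((loopOp K₁).continuous.comp continuous_snd).add (Continuous.coupling
      (hac.comp continuous_fst) (hτc.comp continuous_fst) (hθc.comp continuous_fst) continuous_snd)
  have hLip : ∀ (t : ℝ) (x y : E6), ‖loopOp K₁ x +
      coupling grav K₁ (desiredAcc ξd (max t a)) (τ (max t a)) (upper (x₂ (max t a))) x -
      (loopOp K₁ y +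
        coupling grav K₁ (desiredAcc ξd (max t a)) (τ (max t a)) (upper (x₂ (max t a))) y)‖ ≤
      (‖loopOp K₁‖ + ‖gainOp K₁‖ * (C * (k * ‖sndState x₀‖))) * ‖x - y‖ := by
    intro t x y
    have hte' : ‖thrustError (upper (x₂ (max t a))) (τ (max t a))‖ ≤ C * (k * ‖sndState x₀‖) := by
      refine (hte _ _).trans ?_
      rw [hτ1 _ (hc0 t), mul_one]
      exact mul_le_mul_of_nonneg_left
        ((norm_upper_le _).trans (hx₂le _ (le_max_right _ _))) hC
    have h1 := norm_coupling_sub_le grav K₁ (desiredAcc ξd (max t a)) (τ (max t a))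
      (upper (x₂ (max t a))) x y
    have h2 : ‖loopOp K₁ x - loopOp K₁ y‖ ≤ ‖loopOp K₁‖ * ‖x - y‖ := by
      rw [← map_sub]
      exact (loopOp K₁).le_opNorm _
    rw [add_sub_add_comm, add_mul]
    refine (norm_add_le _ _).trans (add_le_add h2 (h1.trans ?_))
    gcongr
  obtain ⟨x₁, hx₁c, hx₁⟩ :=
    exists_global_solution_add_input hgc (by positivity) hLip hvi a (fstState x₀)
  have hx₁a : x₁ a = fstState x₀ := by simpa using hx₁ a le_rfl
  refine ⟨fun s => mkState (x₁ s) (x₂ s), ?_, fun t ht => ?_⟩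
  · beta_reduce
    rw [hx₁a, hx₂a, mkState_fstState_sndState]
  · refine isSolutionOn_mkState hm ht (fun s hs => ?_)
      (((hgc.comp (continuous_id.prodMk hx₁c)).intervalIntegrable a t).add (hvi a t)) hx₂c
      (fun r hr => ?_) (fun r _ => hx₂ r)
    · simp only [Function.comp_apply, Function.uncurry_apply_pair, id, max_eq_left hs.1,
        hvw s (ha.trans hs.1), add_assoc]
    · rw [hx₁a]
      exact hx₁ r hr.1

end GATracking

end

/-- Closed-loop stability and robustness of the tracking-error dynamics. -/
theorem theorem1 (m grav : ℝ) (hm : 0 < m)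
    -- thrust direction relative to the reference copy of the body (a unit vector, known signal)
    (τ : ℝ → GATracking.E3) (hτ : ContinuousOn τ (Set.Ici 0)) (hτ1 : ∀ t : ℝ, 0 ≤ t → ‖τ t‖ = 1)
    -- desired position, with second derivative bounded uniformly in time
    (ξd : ℝ → GATracking.E3) (hξd : ContDiffOn ℝ 2 ξd (Set.Ici 0))
    (hacc : ∃ C : ℝ, ∀ t : ℝ, 0 ≤ t → ‖GATracking.desiredAcc ξd t‖ ≤ C)
    -- desired angular acceleration
    (angAcc : ℝ → GATracking.State → GATracking.E3 → GATracking.E3)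
    -- gains
    (K₁ K₂ : Matrix (Fin 3) (Fin 3 ⊕ Fin 3) ℝ)
    (hK₁ : GATracking.IsHurwitz (GATracking.matA - GATracking.matB * K₁))
    (hK₂ : GATracking.IsHurwitz (GATracking.matA - GATracking.matB * K₂)) :
    GATracking.ForwardComplete (GATracking.closedLoop m grav τ ξd angAcc K₁ K₂) ∧
    GATracking.IsStronglyIISS (GATracking.closedLoop m grav τ ξd angAcc K₁ K₂) ∧
    GATracking.IsZeroUGAS (GATracking.closedLoop m grav τ ξd angAcc K₁ K₂) := by
  have hiISS := GATracking.closedLoop_isIISS (grav := grav) (angAcc := angAcc) hm hτ1 hacc hK₁ hK₂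
  exact ⟨GATracking.closedLoop_forwardComplete hm hτ hτ1 hξd hK₂,
    ⟨GATracking.closedLoop_isISSSmallInputs hm hτ1 hacc hK₁ hK₂, hiISS⟩, hiISS.isZeroUGAS⟩
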